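/- Let $F=\mathbb F_q$ be a finite field of characteristic $p$, and write vectors as rows. An $(n,k,\delta)$ convolutional code is a submodule $\mathcal C=\{uG\mid u\in F[D]^k\}\subseteq F[D]^n$, where $G\in F[D]^{k\times n}$ is basic (it has a polynomial right inverse) and $\delta$ is the maximal degree of the $k\times k$ minors of $G$. Such a $G$ is a minimal encoder of $\mathcal C$ if moreover its row degrees $\delta_1,\dots,\delta_k$ satisfy $\sum_i\delta_i=\delta$. Let $G$ be a minimal encoder with rows $g_i=\sum_{\nu=0}^{\delta_i}g_{i,\nu}D^\nu$, ordered so that $\delta_1,\dots,\delta_r>0=\delta_{r+1}=\dots=\delta_k$. Its controller canonical form (CCF) is the quadruple $(A,B,C,E)\in F^{\delta\times\delta}\times F^{k\times\delta}\times F^{\delta\times n}\times F^{k\times n}$, where $A$ is block diagonal with blocks $A_i\in F^{\delta_i\times\delta_i}$ ($i\le r$) having ones on the first superdiagonal and zeros elsewhere; the first $r$ rows of $B$ are block diagonal with blocks $(1,0,\dots,0)\in F^{\delta_i}$ and its other rows are zero; $C$ has the rows $g_{1,1},\dots,g_{1,\delta_1},\dots,g_{r,1},\dots,g_{r,\delta_r}$,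 in this order; and $E=G(0)$. A CCF of $\mathcal C$ is the CCF of some such minimal encoder of $\mathcal C$. The weight adjacency matrix (WAM) associated with a CCF is the matrix $\Lambda$ with entries $$\Lambda_{X,Y}=\mathrm{we}\big(\{XC+uE\mid u\in F^k,\ Y=XA+uB\}\big)\in\mathbb C[W],\qquad X,Y\in F^\delta,$$ where $\mathrm{we}(S)=\sum_{j=0}^n\#\{a\in S\mid \mathrm{wt}(a)=j\}\,W^j$ for $S\subseteq F^n$, with $\mathrm{wt}$ the Hamming weight. Let $\mathbf H(f)(W)=(1+(q-1)W)^n f\big(\tfrac{1-W}{1+(q-1)W}\big)$ for $f\in\mathbb C[W]$ with $\deg f\le n$, applied entrywise to matrices. Let $\zeta\in\mathbb C$ be a primitive $p$-th root of unity, let $\tau:F\to\mathbb F_p$ be the trace, and let $\mathcal H=q^{-\delta/2}\big(\zeta^{\tau(XY^{\mathsf T})}\big)_{X,Y\in F^\delta}$. For $P\in GL_\delta(F)$ let $\mathcal P(P)$ be the permutation matrix with $\mathcal P(P)_{X,Y}=1$ if $Y=XP$ and $0$ otherwise, and for a matrix $\Lambda$ over $\mathbb C[W]$ indexed by $F^\delta\times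 F^\delta$ put $[\Lambda]=\{\mathcal P(P)\Lambda\mathcal P(P)^{-1}\mid P\in GL_\delta(F)\}$. **Theorem.** Let $\mathcal C\subseteq F[D]^n$ be an $(n,k,\delta)$ code, let $\Lambda$ be the WAM associated with a CCF of $\mathcal C$, and let $$\widetilde{\mathcal C}=\Big\{w\in F[D]^n\ \Big|\ \langle\langle v,D^lw\rangle\rangle=0\text{ for all }v\in\mathcal C\text{ and }l\in\mathbb N_0\Big\},\qquad \Big\langle\Big\langle\sum_t v_tD^t,\sum_t w_tD^t\Big\rangle\Big\rangle=\sum_t v_tw_t^{\mathsf T},$$ be the sequence space dual of $\mathcal C$. Then every CCF $(\tilde A,\tilde B,\tilde C,\tilde E)$ of $\widetilde{\mathcal C}$ has $n-k$ inputs and state space $F^\delta$, and for its associated WAM $\widetilde\Lambda$ there is $Q\in GL_\delta(F)$ such that $$\widetilde\Lambda_{XQ,YQ}=q^{-k}\,\mathbf H\big((\mathcal H\Lambda\mathcal H^{-1})_{X,Y}\big)\quad\text{for all }X,Y\in F^\delta.$$ Consequently $[\widetilde\Lambda]=q^{-k}\,\mathbf H\big(\mathcal H[\Lambda]\mathcal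 H^{-1}\big):=\{q^{-k}\mathbf H(\mathcal HM\mathcal H^{-1})\mid M\in[\Lambda]\}$. -/

import Mathlib

open Polynomial Matrix

namespace ConvCode

noncomputable section

/-! ### Convolutional codes, encoders and degrees

Polynomials in the delay variable `D` over `F` are elements of `F[X]`; vectors are row vectors. -/

section Codes

variable {F : Type*} [Field F] {k n : ℕ}

/-- `im G = {u G | u ∈ F[D]^k}`, as a submodule of `F[D]^n`. -/
def im (G : Matrix (Fin k) (Fin n) F[X]) : Submodule F[X] (Fin n → F[X]) :=
  LinearMap.range G.vecMulLinear

/-- `G` is basic: it has a polynomial right inverse. -/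
def IsBasic (G : Matrix (Fin k) (Fin n) F[X]) : Prop :=
  ∃ G' : Matrix (Fin n) (Fin k) F[X], G * G' = 1

/-- The degree of the `i`-th row of `G`: the maximal degree of its entries. -/
def rowDegree (G : Matrix (Fin k) (Fin n) F[X]) (i : Fin k) : ℕ :=
  Finset.univ.sup fun j => (G i j).natDegree

/-- The maximal degree of the `k × k` minors of the `k × n` matrix `G`. -/
def maxMinorDegree (G : Matrix (Fin k) (Fin n) F[X]) : ℕ :=
  Finset.univ.sup fun e : Fin k ↪o Fin n => (G.submatrix id e).det.natDegree

/-- `G` is a minimal encoder of the code `𝒞`: it is basic, `𝒞 = im G`, and its row degrees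
add up to the maximal degree of its full-size minors. -/
structure IsMinimalEncoder (𝒞 : Submodule F[X] (Fin n → F[X]))
    (G : Matrix (Fin k) (Fin n) F[X]) : Prop where
  basic : IsBasic G
  im_eq : im G = 𝒞
  minimal : ∑ i, rowDegree G i = maxMinorDegree G

end Codes

/-! ### Sequence space duality -/

section Duality

variable {F : Type*} [Field F] {n : ℕ}

/-- The `F`-bilinear form `⟨⟨∑ v_t D^t, ∑ w_t D^t⟩⟩ = ∑_t v_t w_tᵀ` on `F[D]^n`
(the sum over `t` is taken coordinate by coordinate). -/
def pairing (v w : Fin n → F[X]) : F :=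
  ∑ j, (v j).sum fun t a => a * (w j).coeff t

theorem pairing_add_right (v w w' : Fin n → F[X]) :
    pairing v (w + w') = pairing v w + pairing v w' := by
  simp [pairing, Polynomial.sum, mul_add, Finset.sum_add_distrib]

theorem pairing_C_smul_right (v w : Fin n → F[X]) (c : F) :
    pairing v ((C c : F[X]) • w) = c * pairing v w := by
  simp only [pairing, Polynomial.sum, Finset.mul_sum, Pi.smul_apply, smul_eq_mul, coeff_C_mul]
  exact Finset.sum_congr rfl fun j _ => Finset.sum_congr rfl fun t _ => by ring

/-- The sequence space dual
`{w ∈ F[D]^n | ⟨⟨v, D^l w⟩⟩ = 0 for all v ∈ 𝒞 and all l ∈ ℕ}` of `𝒞`; it is a submodule. -/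
def seqDual (𝒞 : Submodule F[X] (Fin n → F[X])) : Submodule F[X] (Fin n → F[X]) where
  carrier := {w | ∀ v ∈ 𝒞, ∀ l : ℕ, pairing v ((X ^ l : F[X]) • w) = 0}
  zero_mem' := by
    intro v _ l
    simp [pairing, Polynomial.sum]
  add_mem' := by
    intro a b ha hb v hv l
    rw [smul_add, pairing_add_right, ha v hv l, hb v hv l, add_zero]
  smul_mem' := by
    intro p w hw v hv
    induction p using Polynomial.induction_on' with
    | add p q hp hq =>
      intro l
      rw [add_smul, smul_add, pairing_add_right, hp l, hq l, add_zero]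
    | monomial m c =>
      intro l
      have h : (X ^ l : F[X]) • (monomial m c : F[X]) • w
          = (C c : F[X]) • ((X ^ (l + m) : F[X]) • w) := by
        rw [smul_smul, smul_smul, ← C_mul_X_pow_eq_monomial]
        congr 1
        ring
      rw [h, pairing_C_smul_right, hw v hv (l + m), mul_zero]

end Duality

/-! ### Controller canonical form -/

section CCF

variable {F : Type*} [Field F] {k n δ : ℕ}

/-- A quadruple of matrices `(A, B, C, E)` with `k` inputs, `n` outputs and state space `F^δ`. -/
structure Quadruple (F : Type*) (k n δ : ℕ) where
  A : Matrix (Fin δ) (Fin δ) F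
  B : Matrix (Fin k) (Fin δ) F
  C : Matrix (Fin δ) (Fin n) F
  E : Matrix (Fin k) (Fin n) F

/-- The controller canonical form of `G`, where `δ` is the sum of the row degrees `δ_i` of `G`.
The state coordinates are the pairs `(i, a)` with `a < δ_i`, in lexicographic order (through
`finSigmaFinEquiv`). The `i`-th diagonal block of `A` is the `δ_i × δ_i` matrix with ones exactly
on the first superdiagonal, the `i`-th block of `B` is `(1, 0, …, 0)`, the rows of the `i`-th block
of `C` are the coefficients `g_{i,1}, …, g_{i,δ_i}` of the `i`-th row `g_i` of `G`, and
`E = G(0)`. -/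
def ccf (G : Matrix (Fin k) (Fin n) F[X]) (h : ∑ i, rowDegree G i = δ) : Quadruple F k n δ :=
  let pos : Fin δ ≃ (i : Fin k) × Fin (rowDegree G i) :=
    (finSigmaFinEquiv.trans (finCongr h)).symm
  { A := Matrix.of fun s t =>
      if (pos s).1 = (pos t).1 ∧ ((pos t).2 : ℕ) = ((pos s).2 : ℕ) + 1 then 1 else 0
    B := Matrix.of fun i t => if (pos t).1 = i ∧ ((pos t).2 : ℕ) = 0 then 1 else 0
    C := Matrix.of fun s j => (G (pos s).1 j).coeff (((pos s).2 : ℕ) + 1)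
    E := Matrix.of fun i j => (G i j).coeff 0 }

/-- `S` is a controller canonical form of the code `𝒞`: it is the controller canonical form of a
minimal encoder of `𝒞` whose rows of positive degree precede its constant rows. In particular `𝒞`
is then an `(n, k, δ)` code. -/
def Quadruple.IsCCFOf (S : Quadruple F k n δ) (𝒞 : Submodule F[X] (Fin n → F[X])) : Prop :=
  ∃ G : Matrix (Fin k) (Fin n) F[X], IsMinimalEncoder 𝒞 G ∧
    (∀ i j : Fin k, i ≤ j → rowDegree G i = 0 → rowDegree G j = 0) ∧
    ∃ h : ∑ i, rowDegree G i = δ, S = ccf G h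

end CCF

/-! ### Weight adjacency matrix and MacWilliams transformations -/

section Weights

variable {F : Type*} [Field F] [Fintype F] [DecidableEq F] {k n δ : ℕ}

/-- The weight enumerator `we(S) = ∑_{j=0}^n #{a ∈ S | wt(a) = j} W^j` of a subset `S ⊆ F^n`. -/
def weightEnum (S : Set (Fin n → F)) : ℂ[X] :=
  ∑ j ∈ Finset.range (n + 1), C (({a ∈ S | hammingNorm a = j}.ncard : ℕ) : ℂ) * X ^ j

/-- The weight adjacency matrix, with entries
`Λ_{X,Y} = we({X C + u E | u ∈ F^k, Y = X A + u B})` for states `X, Y ∈ F^δ`. -/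
def Quadruple.wam (S : Quadruple F k n δ) : Matrix (Fin δ → F) (Fin δ → F) ℂ[X] :=
  Matrix.of fun x y =>
    weightEnum {v | ∃ u : Fin k → F, y = x ᵥ* S.A + u ᵥ* S.B ∧ v = x ᵥ* S.C + u ᵥ* S.E}

/-- The MacWilliams transform `f ↦ (1 + (q-1)W)^n f((1-W) / (1 + (q-1)W))` on complex polynomials
of degree at most `n`, with the denominators cleared: `W^j` goes to
`(1-W)^j (1 + (q-1)W)^(n-j)`. It is only meaningful (and only used) in degree at most `n`. -/
def macWilliams (q n : ℕ) (f : ℂ[X]) : ℂ[X] :=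
  ∑ j ∈ Finset.range (n + 1),
    C (f.coeff j) * ((1 - X) ^ j * (1 + C ((q : ℂ) - 1) * X) ^ (n - j))

/-- The MacWilliams matrix `q^{-δ/2} (ζ^{τ(X Yᵀ)})_{X,Y ∈ F^δ}`, where `τ` is the trace from `F`
to its prime field `𝔽_p`. -/
def macMatrix (F : Type*) [Field F] [Fintype F] (δ p : ℕ) [Algebra (ZMod p) F] (ζ : ℂ) :
    Matrix (Fin δ → F) (Fin δ → F) ℂ :=
  Matrix.of fun x y =>
    (((Fintype.card F : ℝ) ^ (-(δ : ℝ) / 2) : ℝ) : ℂ) *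
      ζ ^ (Algebra.trace (ZMod p) F (x ⬝ᵥ y)).val

/-- Conjugation `M Λ M⁻¹` of a matrix over `ℂ[W]` by a complex matrix. -/
def conj {ι : Type*} [Fintype ι] [DecidableEq ι] (M : Matrix ι ι ℂ) (Λ : Matrix ι ι ℂ[X]) :
    Matrix ι ι ℂ[X] :=
  M.map C * Λ * (M⁻¹).map C

/-- The permutation matrix `𝒫(P)` of `P ∈ GL_δ(F)`: its `(X,Y)` entry is `1` if `Y = X P`, and `0`
otherwise. -/
def permMatrix (P : GL (Fin δ) F) : Matrix (Fin δ → F) (Fin δ → F) ℂ :=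
  Matrix.of fun x y => if y = x ᵥ* (P : Matrix (Fin δ) (Fin δ) F) then 1 else 0

/-- The class `[Λ] = {𝒫(P) Λ 𝒫(P)⁻¹ | P ∈ GL_δ(F)}`; for a weight adjacency matrix `Λ` of a code
this is the generalized weight adjacency matrix of the code. -/
def genWam (Λ : Matrix (Fin δ → F) (Fin δ → F) ℂ[X]) :
    Set (Matrix (Fin δ → F) (Fin δ → F) ℂ[X]) :=
  {M | ∃ P : GL (Fin δ) F, M = conj (permMatrix P) Λ}

end Weights

end

end ConvCode

/-! The proof is a MacWilliams identity for one trellis section, followed by the identification of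
the dual section. Write the section of `S` as the space of triples (v, vA+uB, vC+uE), and pair
triples by x·v - y·w + d·c. Conjugation by the MacWilliams matrix is a Fourier transform in the two
states, and the MacWilliams transform is one in the output word. Together, up to the factor q^k,
they turn `S.wam` into the enumerator of the orthogonal section x = Ay - Cd, By = Ed
(`macWilliams_conj_wam`).

It remains to match the orthogonal section with the section of a CCF `S'` of the dual code. The
change of states is `stateMatrix`, minus the correlation of the zero-input response of a state of
`S'` with that of a state of `S`. The vanishing of all correlations between codewords of the two
codes makes it carry one section into the other (`section_map`). It is injective: a state in its
kernel has a response orthogonal to every shift of the code, so the response lies in the dual code,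
which minimality of the encoder allows only for the zero state (`stateMatrix_vecMul_eq_zero`,
`ccf_realizes`). By reflexivity of the duality the same holds with the codes exchanged, so the state
spaces have equal dimension. A dimension count, using n ≤ k + k' from `le_add_of_seqDual_le`, turns
the inclusion of sections into an equality (`exists_state_correspondence`). -/

namespace ConvCode

noncomputable section

set_option linter.unusedSectionVars false

/-! ### Additive characters and the Fourier transform of the Hamming weight. -/

section Characters

variable {F : Type*} [Field F] [Fintype F] [DecidableEq F]

/-- The additive character `a ↦ ζ ^ τ(a)` of a finite field. -/
def traceChar (F : Type*) [Field F] (p : ℕ) [Fact p.Prime] [Algebra (ZMod p) F]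
    {ζ : ℂ} (hζ : ζ ^ p = 1) : AddChar F ℂ :=
  (AddChar.zmodChar p hζ).compAddMonoidHom (Algebra.trace (ZMod p) F).toAddMonoidHom

theorem traceChar_apply {p : ℕ} [Fact p.Prime] [Algebra (ZMod p) F]
    {ζ : ℂ} (hζ : ζ ^ p = 1) (a : F) :
    traceChar F p hζ a = ζ ^ (Algebra.trace (ZMod p) F a).val := rfl

theorem traceChar_ne_zero {p : ℕ} [Fact p.Prime] [Algebra (ZMod p) F]
    {ζ : ℂ} (hζ : IsPrimitiveRoot ζ p) : traceChar F p hζ.pow_eq_one ≠ 0 := by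
  intro h
  have hsurj : Function.Surjective (Algebra.trace (ZMod p) F) := Algebra.trace_surjective _ _
  obtain ⟨a, ha⟩ := hsurj 1
  have h1 : traceChar F p hζ.pow_eq_one a = 1 := by rw [h]; rfl
  rw [traceChar_apply, ha, ZMod.val_one'' (Fact.out : p.Prime).one_lt.ne', pow_one] at h1
  exact hζ.ne_one (Fact.out : p.Prime).one_lt h1

theorem sum_addChar_dotProduct {χ : AddChar F ℂ} (hχ : χ ≠ 0) {m : ℕ} (a : Fin m → F) :
    ∑ v : Fin m → F, χ (v ⬝ᵥ a) = if a = 0 then (Fintype.card F : ℂ) ^ m else 0 := by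
  classical
  let ψ : AddChar (Fin m → F) ℂ := χ.compAddMonoidHom
    { toFun := fun v => v ⬝ᵥ a, map_zero' := zero_dotProduct a,
      map_add' := fun v w => add_dotProduct v w a }
  have hψ : ψ = 0 ↔ a = 0 := by
    constructor
    · intro h
      by_contra ha
      obtain ⟨j, hj⟩ := Function.ne_iff.1 ha
      apply hχ
      ext c
      have := DFunLike.congr_fun h (Pi.single j (c / a j))
      have e : ψ (Pi.single j (c / a j)) = χ (Pi.single j (c / a j) ⬝ᵥ a) := rfl
      rw [e, single_dotProduct, div_mul_cancel₀ _ hj] at this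
      simpa using this
    · rintro rfl
      ext v
      have e : ψ v = χ (v ⬝ᵥ 0) := rfl
      rw [e, dotProduct_zero]
      simp
  have := AddChar.sum_eq_ite ψ
  simp only [hψ] at this
  have e : ∀ v, ψ v = χ (v ⬝ᵥ a) := fun v => rfl
  simp only [e] at this
  rw [this]
  simp

theorem addChar_sum_eq_prod {ι : Type*} (χ : AddChar F ℂ) (s : Finset ι) (f : ι → F) :
    χ (∑ i ∈ s, f i) = ∏ i ∈ s, χ (f i) := by
  classical
  induction s using Finset.induction_on with
  | empty => simp
  | insert i s hi ih => rw [Finset.sum_insert hi, Finset.prod_insert hi, AddChar.map_add_eq_mul, ih]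

/-- Both sides factor over the coordinates. A nontrivial character sums to zero over `F`, so a
nonzero coordinate of `c` contributes 1 - W and a zero one contributes 1 + (q-1)W. -/
theorem sum_addChar_weight {χ : AddChar F ℂ} (hχ : χ ≠ 0) {n : ℕ} (c : Fin n → F) :
    ∑ d : Fin n → F, C (χ (c ⬝ᵥ d)) * (X : ℂ[X]) ^ hammingNorm d =
      (1 - X) ^ hammingNorm c * (1 + C ((Fintype.card F : ℂ) - 1) * X) ^ (n - hammingNorm c) := by
  have one_coord : ∀ a : F, ∑ b : F, C (χ (a * b)) * (X : ℂ[X]) ^ (if b = 0 then 0 else 1) =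
      if a ≠ 0 then 1 - X else 1 + C ((Fintype.card F : ℂ) - 1) * X := by
    intro a
    rw [← Finset.add_sum_erase _ _ (Finset.mem_univ (0 : F))]
    have h1 : ∑ b ∈ Finset.univ.erase (0 : F),
        C (χ (a * b)) * (X : ℂ[X]) ^ (if b = 0 then 0 else 1) =
        C (∑ b ∈ Finset.univ.erase (0 : F), χ (a * b)) * X := by
      rw [map_sum, Finset.sum_mul]
      refine Finset.sum_congr rfl fun b hb => ?_
      rw [if_neg (Finset.ne_of_mem_erase hb), pow_one]
    have h2 : ∑ b : F, χ (a * b) = if a = 0 then (Fintype.card F : ℂ) else 0 := by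
      have := sum_addChar_dotProduct hχ (fun _ : Fin 1 => a)
      rw [← (Equiv.funUnique (Fin 1) F).symm.sum_comp] at this
      simp only [dotProduct, Fin.sum_univ_one, pow_one] at this
      have e : (fun _ : Fin 1 => a) = 0 ↔ a = 0 := by rw [funext_iff]; simp
      simp only [e] at this
      rw [← this]
      exact Finset.sum_congr rfl fun b _ => by rw [mul_comm]; rfl
    rw [← Finset.add_sum_erase _ _ (Finset.mem_univ (0 : F))] at h2
    have h3 := eq_sub_of_add_eq' h2
    rw [h1, h3]
    by_cases ha : a = 0
    · simp [ha]
    · simp [ha]; ring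
  have weight : ∀ d : Fin n → F, hammingNorm d = ∑ j, if d j = 0 then 0 else 1 := by
    intro d
    rw [hammingNorm, Finset.card_filter]
    exact Finset.sum_congr rfl fun j _ => by by_cases h : d j = 0 <;> simp [h]
  have step : ∀ d : Fin n → F, C (χ (c ⬝ᵥ d)) * (X : ℂ[X]) ^ hammingNorm d =
      ∏ j, C (χ (c j * d j)) * (X : ℂ[X]) ^ (if d j = 0 then 0 else 1) := by
    intro d
    rw [Finset.prod_mul_distrib, Finset.prod_pow_eq_pow_sum, ← weight, dotProduct,
      addChar_sum_eq_prod, map_prod]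
  simp only [step]
  rw [← Fintype.prod_sum fun j b => C (χ (c j * b)) * (X : ℂ[X]) ^ (if b = 0 then 0 else 1)]
  simp only [one_coord]
  rw [Finset.prod_ite, Finset.prod_const, Finset.prod_const]
  congr 2
  rw [hammingNorm]
  have := Finset.card_filter_add_card_filter_not (s := Finset.univ) (fun j => c j ≠ 0)
  simp only [Finset.card_univ, Fintype.card_fin] at this
  omega

end Characters

/-! ### The MacWilliams identity for a single trellis section. -/

section Transform

/-- The MacWilliams transform as a linear map. -/
def macWilliamsLin (q n : ℕ) : ℂ[X] →ₗ[ℂ] ℂ[X] where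
  toFun := macWilliams q n
  map_add' f g := by
    simp [macWilliams, add_mul, Finset.sum_add_distrib]
  map_smul' a f := by
    simp [macWilliams, Finset.mul_sum, smul_eq_C_mul, mul_assoc]

theorem macWilliams_C_mul_X_pow (q n : ℕ) (a : ℂ) {j : ℕ} (hj : j ≤ n) :
    macWilliamsLin q n (C a * X ^ j) =
      C a * ((1 - X) ^ j * (1 + C ((q : ℂ) - 1) * X) ^ (n - j)) := by
  change macWilliams q n _ = _
  rw [macWilliams, Finset.sum_eq_single j]
  · simp
  · intro i _ hi
    simp [coeff_X_pow, hi]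
  · intro h
    exact absurd (Finset.mem_range.2 (by omega)) h

variable {F : Type*} [Field F] [Fintype F] [DecidableEq F] {k n δ : ℕ}

theorem weightEnum_eq_sum (s : Set (Fin n → F)) [DecidablePred (· ∈ s)] :
    weightEnum s = ∑ v, if v ∈ s then (X : ℂ[X]) ^ hammingNorm v else 0 := by
  rw [weightEnum, ← Finset.sum_filter]
  have hmaps : ∀ v ∈ Finset.univ.filter (· ∈ s), hammingNorm v ∈ Finset.range (n + 1) := by
    intro v _
    have := hammingNorm_le_card_fintype (x := v)
    simp only [Fintype.card_fin] at this
    exact Finset.mem_range.2 (by omega)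
  rw [← Finset.sum_fiberwise_of_maps_to hmaps]
  refine Finset.sum_congr rfl fun j _ => ?_
  have h1 : ∑ v ∈ (Finset.univ.filter (· ∈ s)).filter (fun v => hammingNorm v = j),
      (X : ℂ[X]) ^ hammingNorm v =
      ∑ v ∈ (Finset.univ.filter (· ∈ s)).filter (fun v => hammingNorm v = j), (X : ℂ[X]) ^ j :=
    Finset.sum_congr rfl fun v hv => by rw [(Finset.mem_filter.1 hv).2]
  rw [h1, Finset.sum_const, Finset.filter_filter, nsmul_eq_mul]
  congr 1
  rw [Set.ncard_eq_toFinset_card']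
  simp

theorem vecMul_injective_of_rightInverse {K : Type*} [Field K] {E : Matrix (Fin k) (Fin n) K}
    {R : Matrix (Fin n) (Fin k) K} (h : E * R = 1) : Function.Injective fun u => u ᵥ* E := by
  intro u v huv
  have := congrArg (· ᵥ* R) huv
  simpa [vecMul_vecMul, h] using this

/-- The weight enumerator counts distinct output words, the sum counts inputs. They agree because
the right inverse of `S.E` makes the output determine the input. -/
theorem wam_apply {S : Quadruple F k n δ} {R : Matrix (Fin n) (Fin k) F} (hR : S.E * R = 1)
    (x y : Fin δ → F) :
    S.wam x y = ∑ u : Fin k → F,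
      if y = x ᵥ* S.A + u ᵥ* S.B then (X : ℂ[X]) ^ hammingNorm (x ᵥ* S.C + u ᵥ* S.E) else 0 := by
  classical
  have hinj : Function.Injective fun u : Fin k → F => x ᵥ* S.C + u ᵥ* S.E :=
    fun u v h => vecMul_injective_of_rightInverse hR (add_left_cancel h)
  rw [Quadruple.wam, of_apply, weightEnum_eq_sum, ← Finset.sum_filter, ← Finset.sum_filter]
  rw [← Finset.sum_image (s := Finset.univ.filter fun u : Fin k → F => y = x ᵥ* S.A + u ᵥ* S.B)
    (f := fun v => (X : ℂ[X]) ^ hammingNorm v) (g := fun u => x ᵥ* S.C + u ᵥ* S.E)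
    (hinj.injOn)]
  congr 1
  ext v
  simp only [Finset.mem_filter, Finset.mem_univ, true_and, Set.mem_ofPred_eq, Finset.mem_image]
  exact ⟨fun ⟨u, h1, h2⟩ => ⟨u, h1, h2.symm⟩, fun ⟨u, h1, h2⟩ => ⟨u, h1, h2.symm⟩⟩

variable {p : ℕ} [Fact p.Prime] [Algebra (ZMod p) F] {ζ : ℂ}

theorem macMatrix_apply (hζ : IsPrimitiveRoot ζ p) (x y : Fin δ → F) :
    macMatrix F δ p ζ x y = (((Fintype.card F : ℝ) ^ (-(δ : ℝ) / 2) : ℝ) : ℂ) *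
      traceChar F p hζ.pow_eq_one (x ⬝ᵥ y) := rfl

theorem macScalar_mul_self :
    (((Fintype.card F : ℝ) ^ (-(δ : ℝ) / 2) : ℝ) : ℂ) *
      (((Fintype.card F : ℝ) ^ (-(δ : ℝ) / 2) : ℝ) : ℂ) = ((Fintype.card F : ℂ) ^ δ)⁻¹ := by
  have hq : (0 : ℝ) < Fintype.card F := by exact_mod_cast Fintype.card_pos
  rw [← Complex.ofReal_mul, ← Real.rpow_add hq]
  have : -(δ : ℝ) / 2 + -(δ : ℝ) / 2 = -(δ : ℝ) := by ring
  rw [this, Real.rpow_neg hq.le, Real.rpow_natCast]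
  push_cast
  rfl

theorem card_pow_ne_zero (m : ℕ) : (Fintype.card F : ℂ) ^ m ≠ 0 :=
  pow_ne_zero _ (Nat.cast_ne_zero.2 Fintype.card_ne_zero)

theorem macMatrix_mul_eq_one (hζ : IsPrimitiveRoot ζ p) :
    macMatrix F δ p ζ * (Matrix.of fun x y : Fin δ → F =>
      (((Fintype.card F : ℝ) ^ (-(δ : ℝ) / 2) : ℝ) : ℂ) *
        traceChar F p hζ.pow_eq_one (-(x ⬝ᵥ y))) = 1 := by
  ext x y
  rw [mul_apply]
  simp only [macMatrix_apply hζ, of_apply]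
  set c : ℂ := (((Fintype.card F : ℝ) ^ (-(δ : ℝ) / 2) : ℝ) : ℂ) with hc
  have : ∀ z : Fin δ → F, c * traceChar F p hζ.pow_eq_one (x ⬝ᵥ z) *
      (c * traceChar F p hζ.pow_eq_one (-(z ⬝ᵥ y))) =
      (c * c) * traceChar F p hζ.pow_eq_one (z ⬝ᵥ (x - y)) := by
    intro z
    rw [dotProduct_sub, sub_eq_add_neg, AddChar.map_add_eq_mul, dotProduct_comm x z]
    ring
  simp only [this]
  rw [← Finset.mul_sum, sum_addChar_dotProduct (traceChar_ne_zero hζ), hc, macScalar_mul_self]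
  by_cases h : x = y
  · subst h
    simp [card_pow_ne_zero (F := F) δ]
  · simp [h, sub_eq_zero]

theorem macMatrix_inv_apply (hζ : IsPrimitiveRoot ζ p) (x y : Fin δ → F) :
    (macMatrix F δ p ζ)⁻¹ x y = (((Fintype.card F : ℝ) ^ (-(δ : ℝ) / 2) : ℝ) : ℂ) *
      traceChar F p hζ.pow_eq_one (-(x ⬝ᵥ y)) := by
  rw [inv_eq_right_inv (macMatrix_mul_eq_one hζ), of_apply]

theorem conj_macMatrix_wam_apply (hζ : IsPrimitiveRoot ζ p) {S : Quadruple F k n δ}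
    {R : Matrix (Fin n) (Fin k) F} (hR : S.E * R = 1) (x y : Fin δ → F) :
    conj (macMatrix F δ p ζ) S.wam x y = ∑ v : Fin δ → F, ∑ u : Fin k → F,
      C (((Fintype.card F : ℂ) ^ δ)⁻¹ *
        traceChar F p hζ.pow_eq_one (x ⬝ᵥ v - (v ᵥ* S.A + u ᵥ* S.B) ⬝ᵥ y)) *
        X ^ hammingNorm (v ᵥ* S.C + u ᵥ* S.E) := by
  rw [conj, mul_apply]
  simp only [mul_apply, map_apply, macMatrix_apply hζ, macMatrix_inv_apply hζ, wam_apply hR,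
    Finset.sum_mul, Finset.mul_sum]
  rw [Finset.sum_comm]
  refine Finset.sum_congr rfl fun v _ => ?_
  rw [Finset.sum_comm]
  refine Finset.sum_congr rfl fun u _ => ?_
  rw [Finset.sum_eq_single (v ᵥ* S.A + u ᵥ* S.B)]
  · rw [if_pos rfl, sub_eq_add_neg (x ⬝ᵥ v), AddChar.map_add_eq_mul, ← macScalar_mul_self]
    simp only [map_mul]
    ring
  · intro w _ hw
    rw [if_neg hw]
    simp
  · simp

/-- The MacWilliams identity for the trellis section of `S`: the transformed weight adjacency
matrix enumerates the orthogonal section. -/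
theorem macWilliams_conj_wam (hζ : IsPrimitiveRoot ζ p) {S : Quadruple F k n δ}
    {R : Matrix (Fin n) (Fin k) F} (hR : S.E * R = 1) (x y : Fin δ → F) :
    ((Fintype.card F : ℂ) ^ k)⁻¹ •
      macWilliams (Fintype.card F) n (conj (macMatrix F δ p ζ) S.wam x y) =
    weightEnum {d | x = S.A *ᵥ y - S.C *ᵥ d ∧ S.B *ᵥ y = S.E *ᵥ d} := by
  classical
  have hχ := traceChar_ne_zero (F := F) hζ
  set χ := traceChar F p hζ.pow_eq_one with hχdef
  change _ • macWilliamsLin (Fintype.card F) n _ = _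
  rw [conj_macMatrix_wam_apply hζ hR, map_sum]
  simp only [map_sum]
  have hterm : ∀ (v : Fin δ → F) (u : Fin k → F),
      macWilliamsLin (Fintype.card F) n (C (((Fintype.card F : ℂ) ^ δ)⁻¹ *
        χ (x ⬝ᵥ v - (v ᵥ* S.A + u ᵥ* S.B) ⬝ᵥ y)) * X ^ hammingNorm (v ᵥ* S.C + u ᵥ* S.E)) =
      ∑ d : Fin n → F, C (((Fintype.card F : ℂ) ^ δ)⁻¹ *
        (χ (v ⬝ᵥ (x - S.A *ᵥ y + S.C *ᵥ d)) * χ (u ⬝ᵥ (S.E *ᵥ d - S.B *ᵥ y)))) *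
          X ^ hammingNorm d := by
    intro v u
    -- The transformed monomial is rewritten as a character sum over all words d. The exponents are
    -- then regrouped by v and u, which exposes the two equations of the orthogonal section.
    rw [macWilliams_C_mul_X_pow _ _ _
      (by simpa using hammingNorm_le_card_fintype (x := v ᵥ* S.C + u ᵥ* S.E)),
      ← sum_addChar_weight hχ, Finset.mul_sum]
    refine Finset.sum_congr rfl fun d _ => ?_
    rw [← mul_assoc, ← C_mul, mul_assoc (_⁻¹), ← AddChar.map_add_eq_mul,
      ← AddChar.map_add_eq_mul]
    congr 4
    simp only [dotProduct_add, dotProduct_sub, add_dotProduct, ← dotProduct_mulVec,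
      dotProduct_comm x v]
    ring
  simp only [← hχdef, hterm]
  have hcomm : ∑ v : Fin δ → F, ∑ u : Fin k → F, ∑ d : Fin n → F,
      C (((Fintype.card F : ℂ) ^ δ)⁻¹ *
        (χ (v ⬝ᵥ (x - S.A *ᵥ y + S.C *ᵥ d)) * χ (u ⬝ᵥ (S.E *ᵥ d - S.B *ᵥ y)))) *
          (X : ℂ[X]) ^ hammingNorm d =
      ∑ d : Fin n → F, C (((Fintype.card F : ℂ) ^ δ)⁻¹ *
        ((∑ v : Fin δ → F, χ (v ⬝ᵥ (x - S.A *ᵥ y + S.C *ᵥ d))) *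
          ∑ u : Fin k → F, χ (u ⬝ᵥ (S.E *ᵥ d - S.B *ᵥ y)))) * (X : ℂ[X]) ^ hammingNorm d := by
    simp only [Finset.mul_sum, map_sum, Finset.sum_mul]
    rw [Finset.sum_comm' (t' := Finset.univ) (s' := fun _ => Finset.univ) (by simp)]
    rw [Finset.sum_comm]
    simp only [Finset.sum_comm (s := (Finset.univ : Finset (Fin n → F)))]
    rw [Finset.sum_comm]
  rw [hcomm, weightEnum_eq_sum, Finset.smul_sum]
  refine Finset.sum_congr rfl fun d _ => ?_
  -- The sums over v and u are q^δ and q^k where the equations hold and vanish elsewhere. The first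
  -- cancels the normalization of the two MacWilliams matrices, the second the prefactor q^(-k).
  rw [sum_addChar_dotProduct hχ, sum_addChar_dotProduct hχ]
  have e1 : (x - S.A *ᵥ y + S.C *ᵥ d = 0) ↔ x = S.A *ᵥ y - S.C *ᵥ d := by
    rw [sub_add, sub_eq_zero]
  have e2 : (S.E *ᵥ d - S.B *ᵥ y = 0) ↔ S.B *ᵥ y = S.E *ᵥ d := by
    rw [sub_eq_zero, eq_comm]
  simp only [e1, e2, Set.mem_ofPred_eq]
  have hδ := card_pow_ne_zero (F := F) δ
  have hk := card_pow_ne_zero (F := F) k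
  by_cases h1 : x = S.A *ᵥ y - S.C *ᵥ d
  · by_cases h2 : S.B *ᵥ y = S.E *ᵥ d
    · simp only [h2, if_true, and_true]
      rw [if_pos h1, if_pos h1, smul_eq_C_mul, ← mul_assoc, ← C_mul, inv_mul_cancel_left₀ hδ,
        inv_mul_cancel₀ hk]
      simp
    · simp [h2]
  · simp [h1]

end Transform

/-! ### State space changes and their effect on the MacWilliams matrix. -/

section Permutation

variable {F : Type*} [Field F] [Fintype F] [DecidableEq F] {δ : ℕ}

theorem permMatrix_mul_apply {α : Type*} (P : GL (Fin δ) F)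
    (M : Matrix (Fin δ → F) α ℂ) (x : Fin δ → F) (a : α) :
    (permMatrix P * M) x a = M (x ᵥ* (P : Matrix (Fin δ) (Fin δ) F)) a := by
  simp [mul_apply, permMatrix]

theorem mul_permMatrix_apply {α : Type*} (P : GL (Fin δ) F)
    (M : Matrix α (Fin δ → F) ℂ) (a : α) (y : Fin δ → F) :
    (M * permMatrix P) a y = M a (y ᵥ* ((P⁻¹ : GL (Fin δ) F) : Matrix (Fin δ) (Fin δ) F)) := by
  have h : ∀ z : Fin δ → F, y = z ᵥ* (P : Matrix (Fin δ) (Fin δ) F) ↔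
      z = y ᵥ* ((P⁻¹ : GL (Fin δ) F) : Matrix (Fin δ) (Fin δ) F) := by
    intro z
    constructor
    · rintro rfl
      rw [vecMul_vecMul, ← Units.val_mul, mul_inv_cancel, Units.val_one, vecMul_one]
    · rintro rfl
      rw [vecMul_vecMul, ← Units.val_mul, inv_mul_cancel, Units.val_one, vecMul_one]
  simp [mul_apply, permMatrix, h]

theorem permMatrix_inv (P : GL (Fin δ) F) : (permMatrix P)⁻¹ = permMatrix P⁻¹ := by
  refine inv_eq_right_inv ?_
  ext x y
  rw [permMatrix_mul_apply, permMatrix, of_apply, vecMul_vecMul, ← Units.val_mul,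
    mul_inv_cancel, Units.val_one, vecMul_one, one_apply]
  simp only [eq_comm]

theorem conj_permMatrix_apply (P : GL (Fin δ) F) (Λ : Matrix (Fin δ → F) (Fin δ → F) ℂ[X])
    (x y : Fin δ → F) :
    conj (permMatrix P) Λ x y =
      Λ (x ᵥ* (P : Matrix (Fin δ) (Fin δ) F)) (y ᵥ* (P : Matrix (Fin δ) (Fin δ) F)) := by
  have h : ∀ z : Fin δ → F, y = z ᵥ* ((P⁻¹ : GL (Fin δ) F) : Matrix (Fin δ) (Fin δ) F) ↔
      z = y ᵥ* (P : Matrix (Fin δ) (Fin δ) F) := by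
    intro z
    constructor
    · rintro rfl
      rw [vecMul_vecMul, ← Units.val_mul, inv_mul_cancel, Units.val_one, vecMul_one]
    · rintro rfl
      rw [vecMul_vecMul, ← Units.val_mul, mul_inv_cancel, Units.val_one, vecMul_one]
  rw [conj, permMatrix_inv]
  simp [mul_apply, permMatrix, h, apply_ite, -coe_units_inv]

theorem conj_conj {ι : Type*} [Fintype ι] [DecidableEq ι] (M N : Matrix ι ι ℂ)
    (Λ : Matrix ι ι ℂ[X]) : conj M (conj N Λ) = conj (M * N) Λ := by
  simp only [conj, Matrix.mul_inv_rev, Matrix.map_mul, Matrix.mul_assoc]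

/-- The inverse transpose, as an automorphism of the set `GL`. -/
def invTranspose (P : GL (Fin δ) F) : GL (Fin δ) F where
  val := ((P⁻¹ : GL (Fin δ) F) : Matrix (Fin δ) (Fin δ) F)ᵀ
  inv := (P : Matrix (Fin δ) (Fin δ) F)ᵀ
  val_inv := by rw [← transpose_mul, ← Units.val_mul, mul_inv_cancel]; simp
  inv_val := by rw [← transpose_mul, ← Units.val_mul, inv_mul_cancel]; simp

theorem invTranspose_invTranspose (P : GL (Fin δ) F) : invTranspose (invTranspose P) = P := by
  apply Units.ext
  change ((P : Matrix (Fin δ) (Fin δ) F)ᵀ)ᵀ = _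
  rw [transpose_transpose]

/-- The entries depend only on x·y, so a change of basis on one side moves to the other side as its
inverse transpose. -/
theorem macMatrix_mul_permMatrix {p : ℕ} [Algebra (ZMod p) F] {ζ : ℂ} (P : GL (Fin δ) F) :
    macMatrix F δ p ζ * permMatrix P = permMatrix (invTranspose P) * macMatrix F δ p ζ := by
  ext x y
  rw [mul_permMatrix_apply, permMatrix_mul_apply]
  have : x ⬝ᵥ (y ᵥ* ((P⁻¹ : GL (Fin δ) F) : Matrix (Fin δ) (Fin δ) F)) =
      (x ᵥ* (invTranspose P : Matrix (Fin δ) (Fin δ) F)) ⬝ᵥ y := by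
    change _ = (x ᵥ* (((P⁻¹ : GL (Fin δ) F) : Matrix (Fin δ) (Fin δ) F)ᵀ)) ⬝ᵥ y
    rw [vecMul_transpose, dotProduct_comm, ← dotProduct_mulVec, dotProduct_comm]
  rw [macMatrix, of_apply, of_apply, this]

/-- A transformation rule for weight adjacency matrices extends to their conjugacy classes. -/
theorem genWam_eq_image {p : ℕ} [Algebra (ZMod p) F] {ζ : ℂ}
    {Λ Λ' : Matrix (Fin δ → F) (Fin δ → F) ℂ[X]} {H : ℂ[X] → ℂ[X]} (a : ℂ) (Q : GL (Fin δ) F)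
    (hQ : ∀ x y : Fin δ → F,
      Λ' (x ᵥ* (Q : Matrix (Fin δ) (Fin δ) F)) (y ᵥ* (Q : Matrix (Fin δ) (Fin δ) F)) =
        a • H (conj (macMatrix F δ p ζ) Λ x y)) :
    genWam Λ' = (fun M => a • (conj (macMatrix F δ p ζ) M).map H) '' genWam Λ := by
  have key : ∀ P : GL (Fin δ) F,
      a • (conj (macMatrix F δ p ζ) (conj (permMatrix P) Λ)).map H =
        conj (permMatrix (invTranspose P * Q)) Λ' := by
    intro P
    ext1 x y
    rw [conj_conj, macMatrix_mul_permMatrix, ← conj_conj, Matrix.smul_apply, map_apply,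
      conj_permMatrix_apply, conj_permMatrix_apply, ← hQ, vecMul_vecMul, vecMul_vecMul,
      Units.val_mul]
  ext M
  constructor
  · rintro ⟨P, rfl⟩
    -- The solution R of `invTranspose R * Q = P`, since `invTranspose` is an involution.
    refine ⟨_, ⟨invTranspose (P * Q⁻¹), rfl⟩, ?_⟩
    simp only [key]
    rw [invTranspose_invTranspose, inv_mul_cancel_right]
  · rintro ⟨_, ⟨P, rfl⟩, rfl⟩
    exact ⟨_, key P⟩

end Permutation

/-! ### Sequence space duality: generators, reversal and reflexivity. -/

section Pairing

variable {F : Type*} [Field F] {k k' n : ℕ}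

/-- The vector of coefficients of `D ^ t` in a polynomial vector. -/
def coeffVec (w : Fin n → F[X]) (t : ℕ) : Fin n → F := fun j => (w j).coeff t

/-- The matrix of coefficients of `D ^ t` in a polynomial matrix. -/
def coeffMat (G : Matrix (Fin k) (Fin n) F[X]) (t : ℕ) : Matrix (Fin k) (Fin n) F :=
  G.map fun f => f.coeff t

theorem exists_coeffVec_eq_zero (w : Fin n → F[X]) : ∃ N, ∀ t, N ≤ t → coeffVec w t = 0 := by
  refine ⟨(Finset.univ.sup fun j => (w j).natDegree) + 1, fun t ht => funext fun j => ?_⟩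
  have := Finset.le_sup (f := fun j => (w j).natDegree) (Finset.mem_univ j)
  exact coeff_eq_zero_of_natDegree_lt (Nat.lt_of_succ_le ((Nat.succ_le_succ this).trans ht))

theorem coeffVec_X_pow_smul (a : ℕ) (w : Fin n → F[X]) (t : ℕ) :
    coeffVec ((X ^ a : F[X]) • w) t = if a ≤ t then coeffVec w (t - a) else 0 := by
  funext j
  simp only [coeffVec, Pi.smul_apply, smul_eq_mul, coeff_X_pow_mul']
  split_ifs <;> rfl

theorem pairing_eq_sum {v : Fin n → F[X]} {N : ℕ} (hv : ∀ t, N ≤ t → coeffVec v t = 0)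
    (w : Fin n → F[X]) :
    pairing v w = ∑ t ∈ Finset.range N, coeffVec v t ⬝ᵥ coeffVec w t := by
  simp only [pairing, dotProduct]
  rw [Finset.sum_comm]
  refine Finset.sum_congr rfl fun j _ => ?_
  rw [Polynomial.sum]
  refine Finset.sum_subset (fun t ht => ?_) fun t _ ht => ?_
  · by_contra h
    exact (mem_support_iff.1 ht)
      (congrFun (hv t (not_lt.1 fun h' => h (Finset.mem_range.2 h'))) j)
  · rw [notMem_support_iff.1 ht, zero_mul]

theorem pairing_comm (v w : Fin n → F[X]) : pairing v w = pairing w v := by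
  obtain ⟨N, hN⟩ := exists_coeffVec_eq_zero v
  obtain ⟨M, hM⟩ := exists_coeffVec_eq_zero w
  rw [pairing_eq_sum (N := max N M) fun t ht => hN t (le_trans (le_max_left _ _) ht),
    pairing_eq_sum (N := max N M) fun t ht => hM t (le_trans (le_max_right _ _) ht)]
  exact Finset.sum_congr rfl fun t _ => dotProduct_comm _ _

theorem pairing_X_pow_smul_left {v : Fin n → F[X]} {N : ℕ}
    (hv : ∀ t, N ≤ t → coeffVec v t = 0) (a : ℕ) (w : Fin n → F[X]) :
    pairing ((X ^ a : F[X]) • v) w =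
      ∑ t ∈ Finset.range N, coeffVec v t ⬝ᵥ coeffVec w (a + t) := by
  rw [pairing_eq_sum (N := a + N), Finset.sum_range_add]
  · rw [Finset.sum_eq_zero, zero_add]
    · refine Finset.sum_congr rfl fun t _ => ?_
      rw [coeffVec_X_pow_smul, if_pos (Nat.le_add_right _ _), Nat.add_sub_cancel_left]
    · intro t ht
      rw [coeffVec_X_pow_smul, if_neg (not_le.2 (Finset.mem_range.1 ht)), zero_dotProduct]
  · intro t ht
    rw [coeffVec_X_pow_smul, if_pos (by omega), hv _ (by omega)]

theorem pairing_X_pow_smul_smul (a : ℕ) (v w : Fin n → F[X]) :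
    pairing ((X ^ a : F[X]) • v) ((X ^ a : F[X]) • w) = pairing v w := by
  obtain ⟨N, hN⟩ := exists_coeffVec_eq_zero v
  rw [pairing_X_pow_smul_left hN, pairing_eq_sum hN]
  refine Finset.sum_congr rfl fun t _ => ?_
  rw [coeffVec_X_pow_smul, if_pos (Nat.le_add_right _ _), Nat.add_sub_cancel_left]

theorem row_mem_im (G : Matrix (Fin k) (Fin n) F[X]) (i : Fin k) : G i ∈ im G :=
  ⟨Pi.single i 1, by
    change Pi.single i 1 ᵥ* G = G i
    rw [single_one_vecMul]; rfl⟩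

/-- Only the relative shift of two vectors matters, since a common power of D cancels in the
pairing. Without negative powers of D, its two directions need separate conditions on the rows. -/
theorem mem_seqDual_im {G : Matrix (Fin k) (Fin n) F[X]} {w : Fin n → F[X]} :
    w ∈ seqDual (im G) ↔ ∀ i a, pairing (G i) ((X ^ a : F[X]) • w) = 0 ∧
      pairing ((X ^ a : F[X]) • G i) w = 0 := by
  constructor
  · intro h i a
    refine ⟨h _ (row_mem_im G i) a, ?_⟩
    simpa using h _ ((im G).smul_mem (X ^ a) (row_mem_im G i)) 0
  · rintro h _ ⟨u, rfl⟩ l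
    change pairing (u ᵥ* G) _ = 0
    rw [vecMul_eq_sum, pairing_comm]
    have hsum : ∀ (s : Finset (Fin k)) (x : Fin n → F[X]),
        (∀ i ∈ s, pairing x (u i • G i) = 0) → pairing x (∑ i ∈ s, u i • G i) = 0 := by
      intro s x hx
      induction s using Finset.cons_induction with
      | empty => simp [pairing, Polynomial.sum]
      | cons i s hi ih =>
        rw [Finset.sum_cons, pairing_add_right, hx i (Finset.mem_cons_self _ _),
          ih fun j hj => hx j (Finset.mem_cons_of_mem hj), add_zero]
    refine hsum _ _ fun i _ => ?_
    induction u i using Polynomial.induction_on' with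
    | add p q hp hq => rw [add_smul, pairing_add_right, hp, hq, add_zero]
    | monomial m c =>
      rw [← C_mul_X_pow_eq_monomial, ← smul_smul, pairing_C_smul_right, pairing_comm]
      rcases le_total m l with hml | hml
      · obtain ⟨b, rfl⟩ := Nat.exists_eq_add_of_le hml
        rw [pow_add, ← smul_smul, pairing_X_pow_smul_smul, (h i b).1, mul_zero]
      · obtain ⟨b, rfl⟩ := Nat.exists_eq_add_of_le hml
        rw [pow_add, ← smul_smul, pairing_X_pow_smul_smul, (h i b).2, mul_zero]

/-- Pairing with a reflected vector extracts a coefficient of the ordinary scalar product. -/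
theorem pairing_reflect {z : Fin n → F[X]} {m : ℕ} (hz : ∀ j, (z j).natDegree ≤ m)
    (v : Fin n → F[X]) :
    pairing v (fun j => (z j).reflect m) = (v ⬝ᵥ z).coeff m := by
  have hw : ∀ t, m + 1 ≤ t → coeffVec (fun j => (z j).reflect m) t = 0 := by
    intro t ht
    funext j
    rw [coeffVec, coeff_reflect, revAt_eq_self_of_lt (by omega)]
    exact coeff_eq_zero_of_natDegree_lt (lt_of_le_of_lt (hz j) (by omega))
  rw [pairing_comm, pairing_eq_sum hw]
  simp only [dotProduct, finsetSum_coeff, coeff_mul]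
  rw [Finset.sum_comm]
  refine Finset.sum_congr rfl fun j _ => ?_
  rw [Finset.Nat.sum_antidiagonal_eq_sum_range_succ fun a b => (v j).coeff a * (z j).coeff b]
  refine Finset.sum_congr rfl fun t ht => ?_
  rw [coeffVec, coeff_reflect, revAt_le (Nat.lt_succ_iff.1 (Finset.mem_range.1 ht)), mul_comm]
  rfl

theorem X_pow_smul_reflect {z : Fin n → F[X]} {m : ℕ} (hz : ∀ j, (z j).natDegree ≤ m) (l : ℕ) :
    ((X ^ l : F[X]) • fun j => (z j).reflect m) = fun j => (z j).reflect (l + m) := by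
  funext j
  have := reflect_mul (1 : F[X]) (z j) (F := l) (by simp) (hz j)
  rw [one_mul, reflect_one] at this
  rw [this]
  rfl

theorem reflect_mem_seqDual {G : Matrix (Fin k) (Fin n) F[X]} {z : Fin n → F[X]} {m : ℕ}
    (hz : ∀ j, (z j).natDegree ≤ m) (h : G *ᵥ z = 0) :
    (fun j => (z j).reflect m) ∈ seqDual (im G) := by
  rintro _ ⟨u, rfl⟩ l
  change pairing (u ᵥ* G) _ = 0
  rw [X_pow_smul_reflect hz, pairing_reflect fun j => (hz j).trans (Nat.le_add_left _ _),
    ← dotProduct_mulVec, h, dotProduct_zero, coeff_zero]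

theorem exists_natDegree_le (z : Fin n → F[X]) : ∃ m, ∀ j, (z j).natDegree ≤ m :=
  ⟨Finset.univ.sup fun j => (z j).natDegree,
    fun j => Finset.le_sup (f := fun j => (z j).natDegree) (Finset.mem_univ j)⟩

/-- Reflexivity of basic codes under sequence space duality. -/
theorem seqDual_seqDual_le {G : Matrix (Fin k) (Fin n) F[X]} (hG : IsBasic G) :
    seqDual (seqDual (im G)) ≤ im G := by
  intro f hf
  obtain ⟨R, hR⟩ := hG
  -- The columns of 1 - RG lie in the kernel of G, so their reversals lie in the dual code.
  -- Orthogonality to these forces f = (fR)G.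
  have key : f ᵥ* (1 - R * G : Matrix (Fin n) (Fin n) F[X]) = 0 := by
    funext j
    set z : Fin n → F[X] := fun i => (1 - R * G : Matrix (Fin n) (Fin n) F[X]) i j with hz
    have hGz : G *ᵥ z = 0 := by
      have : G * (1 - R * G : Matrix (Fin n) (Fin n) F[X]) = 0 := by
        rw [Matrix.mul_sub, ← Matrix.mul_assoc, hR, Matrix.mul_one, Matrix.one_mul, sub_self]
      funext i
      exact congrFun (congrFun this i) j
    obtain ⟨m, hm⟩ := exists_natDegree_le z
    change f ⬝ᵥ z = 0
    ext c
    have hm' : ∀ j, (z j).natDegree ≤ m + c := fun j => (hm j).trans (Nat.le_add_right _ _)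
    -- Reversing at degree m + c and shifting f by m isolates the coefficient of index c, while
    -- keeping the reversal degree at least deg z for every c.
    have h := hf _ (reflect_mem_seqDual hm' hGz) m
    rw [pairing_comm, pairing_reflect hm', smul_dotProduct, smul_eq_mul, coeff_X_pow_mul',
      if_pos (Nat.le_add_right _ _), Nat.add_sub_cancel_left] at h
    rw [h, coeff_zero]
  refine ⟨f ᵥ* R, ?_⟩
  change (f ᵥ* R) ᵥ* G = f
  rw [vecMul_sub, vecMul_one, sub_eq_zero] at key
  rw [vecMul_vecMul, ← key]

theorem eval_one_reflect (p : F[X]) (m : ℕ) (h : p.natDegree ≤ m) :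
    (p.reflect m).eval 1 = p.eval 1 := by
  have : Invertible (1 : F) := invertibleOne
  have := eval₂_reflect_mul_pow (RingHom.id F) 1 m p h
  simpa [eval₂_id] using this

/-- The dimensions of a basic code and a code containing its dual add up to at least `n`. -/
theorem le_add_of_seqDual_le {G : Matrix (Fin k) (Fin n) F[X]} (hG : IsBasic G)
    {G' : Matrix (Fin k') (Fin n) F[X]} (hle : seqDual (im G) ≤ im G') : n ≤ k + k' := by
  obtain ⟨R, hR⟩ := hG
  let ev := evalRingHom (1 : F)
  -- Reversal preserves values at D = 1. Every a in ker G(1) is the value at 1 of z = (1 - RG)a with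
  -- Gz = 0; the reversal of z is a dual codeword, so a lies in the row space of G'(1).
  have hker : LinearMap.ker (G.map ev).mulVecLin ≤ LinearMap.range (G'.map ev).vecMulLinear := by
    intro a ha
    have ha : G.map ev *ᵥ a = 0 := ha
    set z : Fin n → F[X] := (1 - R * G : Matrix (Fin n) (Fin n) F[X]) *ᵥ (fun j => C (a j)) with hz
    have hGz : G *ᵥ z = 0 := by
      rw [hz, mulVec_mulVec, Matrix.mul_sub, ← Matrix.mul_assoc, hR, Matrix.mul_one,
        Matrix.one_mul, sub_self, zero_mulVec]
    obtain ⟨m, hm⟩ := exists_natDegree_le z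
    obtain ⟨u, hu⟩ := hle (reflect_mem_seqDual hm hGz)
    have hu : u ᵥ* G' = _ := hu
    have hza : ∀ j, ev (z j) = a j := by
      intro j
      rw [hz, sub_mulVec, one_mulVec, ← mulVec_mulVec, Pi.sub_apply, map_sub]
      have h1 : ev ((R *ᵥ (G *ᵥ fun j => C (a j))) j) = 0 := by
        rw [RingHom.map_mulVec]
        have h2 : (ev ∘ (G *ᵥ fun j => C (a j))) = 0 := by
          funext i
          rw [Function.comp_apply, RingHom.map_mulVec, ← ha]
          congr 2
          funext j
          simp [ev]
        rw [h2, mulVec_zero, Pi.zero_apply]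
      rw [h1, sub_zero]
      simp [ev]
    refine ⟨ev ∘ u, funext fun j => ?_⟩
    change ((ev ∘ u) ᵥ* G'.map ev) j = a j
    rw [← RingHom.map_vecMul, hu, ← hza]
    exact eval_one_reflect _ _ (hm j)
  have h1 := LinearMap.finrank_range_add_finrank_ker (G.map ev).mulVecLin
  have h2 := Submodule.finrank_mono hker
  have h3 := (LinearMap.range (G.map ev).mulVecLin).finrank_le
  have h4 := LinearMap.finrank_range_le (G'.map ev).vecMulLinear
  simp only [Module.finrank_fin_fun] at h1 h3 h4
  omega

end Pairing

/-! ### State space realizations of a code and its dual, and the map between their states. -/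

section Realization

variable {F : Type*} [Field F] {k k' n δ δ' : ℕ}

/-- `S` is a reachable realization of the encoder `G` with nilpotent state matrix, in which no
nonzero state has a zero-input response lying in the code `im G`. -/
structure Realizes (S : Quadruple F k n δ) (G : Matrix (Fin k) (Fin n) F[X]) : Prop where
  coeff_zero : S.E = coeffMat G 0
  coeff_succ : ∀ s, S.B * S.A ^ s * S.C = coeffMat G (s + 1)
  nilpotent : ∃ N, S.A ^ N = 0
  reachable : ∀ x : Fin δ → F, (∀ s, (S.B * S.A ^ s) *ᵥ x = 0) → x = 0
  observable : ∀ (x : Fin δ → F) (f : Fin n → F[X]),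
    (∀ t, coeffVec f t = x ᵥ* (S.A ^ t * S.C)) → f ∈ im G → x = 0

theorem Realizes.coeffMat_eq_zero {S : Quadruple F k n δ} {G : Matrix (Fin k) (Fin n) F[X]}
    (h : Realizes S G) {N : ℕ} (hN : S.A ^ N = 0) {t : ℕ} (ht : N + 1 ≤ t) :
    coeffMat G t = 0 := by
  obtain ⟨s, rfl⟩ := Nat.exists_eq_add_of_le ht
  rw [show N + 1 + s = (N + s) + 1 by omega, ← h.coeff_succ, pow_add, hN]
  simp

/-- All correlations between the rows of `G` and the rows of `G'` vanish. -/
def Orth (N : ℕ) (G : Matrix (Fin k) (Fin n) F[X]) (G' : Matrix (Fin k') (Fin n) F[X]) : Prop :=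
  ∀ a, ∑ s ∈ Finset.range N, coeffMat G (a + s) * (coeffMat G' s)ᵀ = 0 ∧
    ∑ s ∈ Finset.range N, coeffMat G s * (coeffMat G' (a + s))ᵀ = 0

theorem Orth.symm {N : ℕ} {G : Matrix (Fin k) (Fin n) F[X]} {G' : Matrix (Fin k') (Fin n) F[X]}
    (h : Orth N G G') : Orth N G' G := by
  intro a
  have h1 := congrArg transpose (h a).1
  have h2 := congrArg transpose (h a).2
  simp only [transpose_sum, transpose_mul, transpose_transpose, transpose_zero] at h1 h2
  exact ⟨h2, h1⟩

theorem orth_of_im_le_seqDual {N : ℕ} {G : Matrix (Fin k) (Fin n) F[X]}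
    {G' : Matrix (Fin k') (Fin n) F[X]} (hG : ∀ t, N ≤ t → coeffMat G t = 0)
    (hG' : ∀ t, N ≤ t → coeffMat G' t = 0) (h : im G' ≤ seqDual (im G)) : Orth N G G' := by
  intro a
  have hrow := fun i' => mem_seqDual_im.1 (h (row_mem_im G' i'))
  constructor
  · ext i i'
    have := (hrow i' i a).1
    rw [pairing_comm, pairing_X_pow_smul_left fun t ht => congrFun (hG' t ht) i'] at this
    simp only [Matrix.sum_apply, mul_apply', Matrix.zero_apply]
    rw [← this]
    exact Finset.sum_congr rfl fun t _ => dotProduct_comm _ _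
  · ext i i'
    have := (hrow i' i a).2
    rw [pairing_X_pow_smul_left fun t ht => congrFun (hG t ht) i] at this
    simp only [Matrix.sum_apply, mul_apply', Matrix.zero_apply]
    rw [← this]
    rfl

/-- The matrix of the correspondence between the states of `S'` and those of the section
orthogonal to `S`. -/
def stateMatrix (N : ℕ) (S : Quadruple F k n δ) (S' : Quadruple F k' n δ') :
    Matrix (Fin δ') (Fin δ) F :=
  -∑ s ∈ Finset.range N, S'.A ^ s * S'.C * (S.A ^ s * S.C)ᵀ

theorem stateMatrix_transpose (N : ℕ) (S : Quadruple F k n δ) (S' : Quadruple F k' n δ') :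
    (stateMatrix N S S')ᵀ = stateMatrix N S' S := by
  simp only [stateMatrix, transpose_neg, transpose_sum, transpose_mul, transpose_transpose]

section Pair

variable {S : Quadruple F k n δ} {S' : Quadruple F k' n δ'}
  {G : Matrix (Fin k) (Fin n) F[X]} {G' : Matrix (Fin k') (Fin n) F[X]} {N : ℕ}

/-- A codeword of `G'` starting now sees only the future of a codeword of `G`, that is, the response
of its current state. Multiplication by BA^r gives a correlation at lag r + 1, which vanishes, and
reachability removes the factor BA^r. -/
theorem sum_response_mul_coeffMat (h : Realizes S G) (hO : Orth N G G') :
    ∑ s ∈ Finset.range N, S.A ^ s * S.C * (coeffMat G' s)ᵀ = 0 := by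
  ext x j
  refine congrFun (h.reachable (fun x => (∑ s ∈ Finset.range N,
    S.A ^ s * S.C * (coeffMat G' s)ᵀ) x j) fun r => ?_) x
  have : (S.B * S.A ^ r) * ∑ s ∈ Finset.range N, S.A ^ s * S.C * (coeffMat G' s)ᵀ = 0 := by
    rw [Matrix.mul_sum, ← (hO (r + 1)).1]
    refine Finset.sum_congr rfl fun s _ => ?_
    rw [show r + 1 + s = (r + s) + 1 by omega, ← h.coeff_succ, pow_add]
    simp only [Matrix.mul_assoc]
  funext i
  exact congrFun (congrFun this i) j

variable (h : Realizes S G) (h' : Realizes S' G') (hN : S.A ^ N = 0) (hN' : S'.A ^ N = 0)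
  (hO : Orth (N + 1) G G')

include hN in
-- The s = 0 term of the correlation sum is split off; the remaining terms are the correlation one
-- time step later, and nilpotency kills the extra last term.
theorem stateMatrix_eq :
    stateMatrix N S S' = S'.A * stateMatrix N S S' * S.Aᵀ - S'.C * S.Cᵀ := by
  have h1 : ∑ s ∈ Finset.range N, S'.A ^ s * S'.C * (S.A ^ s * S.C)ᵀ =
      ∑ s ∈ Finset.range (N + 1), S'.A ^ s * S'.C * (S.A ^ s * S.C)ᵀ := by
    rw [Finset.sum_range_succ, hN]
    simp
  have h2 : S'.A * (∑ s ∈ Finset.range N, S'.A ^ s * S'.C * (S.A ^ s * S.C)ᵀ) * S.Aᵀ =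
      ∑ s ∈ Finset.range N, S'.A ^ (s + 1) * S'.C * (S.A ^ (s + 1) * S.C)ᵀ := by
    rw [Matrix.mul_sum, Matrix.sum_mul]
    refine Finset.sum_congr rfl fun s _ => ?_
    rw [pow_succ' S'.A, pow_succ' S.A]
    simp only [transpose_mul, Matrix.mul_assoc]
  rw [stateMatrix, Matrix.mul_neg, Matrix.neg_mul, h2, h1, Finset.sum_range_succ']
  simp only [pow_zero, Matrix.one_mul]
  abel

include h' h hO in
-- After the index shift the left side is the vanishing sum of `sum_response_mul_coeffMat`, negated
-- and without its s = 0 term.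
theorem input_stateMatrix_state :
    S'.B * stateMatrix N S S' * S.Aᵀ = S'.E * S.Cᵀ := by
  have h1 := congrArg transpose (sum_response_mul_coeffMat h hO)
  simp only [transpose_sum, transpose_mul (S.A ^ _ * S.C), transpose_transpose,
    transpose_zero] at h1
  rw [Finset.sum_range_succ', ← h'.coeff_zero, pow_zero, Matrix.one_mul] at h1
  rw [stateMatrix, Matrix.mul_neg, Matrix.neg_mul, neg_eq_iff_add_eq_zero, ← h1,
    add_left_inj, Matrix.mul_sum, Matrix.sum_mul]
  refine Finset.sum_congr rfl fun s _ => ?_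
  rw [← h'.coeff_succ, pow_succ' S.A]
  simp only [transpose_mul, Matrix.mul_assoc]

include h' h hO in
theorem state_stateMatrix_input :
    S'.A * stateMatrix N S S' * S.Bᵀ = S'.C * S.Eᵀ := by
  have := congrArg transpose (input_stateMatrix_state h' h hO.symm)
  rw [← stateMatrix_transpose] at this
  simpa only [transpose_mul, transpose_transpose, Matrix.mul_assoc] using this

include h' h hO in
theorem input_stateMatrix_input :
    S'.B * stateMatrix N S S' * S.Bᵀ = S'.E * S.Eᵀ := by
  have h1 := (hO.symm 0).1
  simp only [zero_add] at h1
  rw [Finset.sum_range_succ', ← h'.coeff_zero, ← h.coeff_zero] at h1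
  rw [stateMatrix, Matrix.mul_neg, Matrix.neg_mul, neg_eq_iff_add_eq_zero, ← h1,
    add_left_inj, Matrix.mul_sum, Matrix.sum_mul]
  refine Finset.sum_congr rfl fun s _ => ?_
  rw [← h'.coeff_succ, ← h.coeff_succ]
  simp only [transpose_mul, Matrix.mul_assoc]

include h' h hN hO in
/-- The state matrix maps the section of `S'` into the section orthogonal to `S`. -/
theorem section_map {x y : Fin δ' → F} {u : Fin k' → F} {d : Fin n → F}
    (hy : y = x ᵥ* S'.A + u ᵥ* S'.B) (hd : d = x ᵥ* S'.C + u ᵥ* S'.E) :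
    x ᵥ* stateMatrix N S S' = S.A *ᵥ (y ᵥ* stateMatrix N S S') - S.C *ᵥ d ∧
      S.B *ᵥ (y ᵥ* stateMatrix N S S') = S.E *ᵥ d := by
  simp only [← vecMul_transpose]
  constructor
  · conv_lhs => rw [stateMatrix_eq hN]
    rw [hy, hd]
    simp only [add_vecMul, vecMul_vecMul, input_stateMatrix_state h h' hO, vecMul_sub]
    abel
  · rw [hy, hd]
    simp only [add_vecMul, vecMul_vecMul, input_stateMatrix_input h h' hO,
      state_stateMatrix_input h h' hO]

include h' h hN hN' hO in
theorem stateMatrix_vecMul_eq_zero (hle : seqDual (im G) ≤ im G') {x : Fin δ' → F}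
    (hx : x ᵥ* stateMatrix N S S' = 0) : x = 0 := by
  set f : Fin n → F[X] := fun j =>
    ∑ t ∈ Finset.range N, C ((x ᵥ* (S'.A ^ t * S'.C)) j) * X ^ t with hf
  have hcoeff : ∀ t, coeffVec f t = x ᵥ* (S'.A ^ t * S'.C) := by
    intro t
    funext j
    simp only [coeffVec, hf, finsetSum_coeff, coeff_C_mul, coeff_X_pow, mul_ite, mul_one,
      mul_zero, Finset.sum_ite_eq, Finset.mem_range]
    split_ifs with ht
    · rfl
    · obtain ⟨s, rfl⟩ := Nat.exists_eq_add_of_le (not_lt.1 ht)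
      rw [pow_add, hN']
      simp
  have hfN : ∀ t, N ≤ t → coeffVec f t = 0 := by
    intro t ht
    obtain ⟨s, rfl⟩ := Nat.exists_eq_add_of_le ht
    rw [hcoeff, pow_add, hN']
    simp
  -- Rows of G that start at or after the initial time of f.
  have hback : ∀ a, ∑ t ∈ Finset.range (N + 1),
      coeffMat G t *ᵥ coeffVec f (a + t) = 0 := by
    intro a
    have h1 := sum_response_mul_coeffMat h' hO.symm
    have h2 : x ᵥ* (S'.A ^ a * ∑ s ∈ Finset.range (N + 1),
        S'.A ^ s * S'.C * (coeffMat G s)ᵀ) = 0 := by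
      rw [h1, Matrix.mul_zero, vecMul_zero]
    rw [← h2, Matrix.mul_sum, vecMul_sum]
    refine Finset.sum_congr rfl fun t _ => ?_
    rw [hcoeff, ← vecMul_transpose, vecMul_vecMul, pow_add]
    simp only [Matrix.mul_assoc]
  -- Rows of G that start r + 1 steps earlier: their remaining part is the response of the states
  -- BA^r, so its correlation with f is read off from the state matrix, where x gives zero.
  have hforw : ∀ r, ∑ t ∈ Finset.range N, coeffMat G (r + 1 + t) *ᵥ coeffVec f t = 0 := by
    intro r
    have h2 : x ᵥ* (stateMatrix N S S' * (S.B * S.A ^ r)ᵀ) = 0 := by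
      rw [← vecMul_vecMul, hx, zero_vecMul]
    rw [stateMatrix, Matrix.neg_mul, vecMul_neg, neg_eq_zero, Matrix.sum_mul, vecMul_sum] at h2
    rw [← h2]
    refine Finset.sum_congr rfl fun t _ => ?_
    rw [hcoeff, ← vecMul_transpose, vecMul_vecMul, show r + 1 + t = (r + t) + 1 by omega,
      ← h.coeff_succ, pow_add]
    simp only [Matrix.mul_assoc, transpose_mul]
  have hGN : ∀ i t, N + 1 ≤ t → coeffVec (G i) t = 0 := by
    intro i t ht
    exact congrFun (h.coeffMat_eq_zero hN ht) i
  have hmem : f ∈ seqDual (im G) := by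
    rw [mem_seqDual_im]
    have hleft : ∀ i a, pairing ((X ^ a : F[X]) • G i) f = 0 := by
      intro i a
      rw [pairing_X_pow_smul_left (hGN i)]
      have := congrFun (hback a) i
      rw [Finset.sum_apply] at this
      exact this
    refine fun i a => ⟨?_, hleft i a⟩
    cases a with
    | zero => simpa using hleft i 0
    | succ r =>
      rw [pairing_comm, pairing_X_pow_smul_left hfN]
      have := congrFun (hforw r) i
      rw [Finset.sum_apply] at this
      refine Eq.trans ?_ this
      exact Finset.sum_congr rfl fun t _ => dotProduct_comm _ _
  exact h'.observable x f hcoeff (hle hmem)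

end Pair

end Realization

/-! ### Row reducedness and the predictable degree property. -/

section LeadingCoefficients

variable {F : Type*} [Field F] {k n : ℕ}

theorem coeff_prod_sum_of_natDegree_le {ι : Type*} (s : Finset ι) (f : ι → F[X]) (d : ι → ℕ)
    (h : ∀ i ∈ s, (f i).natDegree ≤ d i) :
    (∏ i ∈ s, f i).coeff (∑ i ∈ s, d i) = ∏ i ∈ s, (f i).coeff (d i) := by
  induction s using Finset.cons_induction with
  | empty => simp
  | cons i s hi ih =>
    have hs : ∀ j ∈ s, (f j).natDegree ≤ d j := fun j hj => h j (Finset.mem_cons_of_mem hj)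
    rw [Finset.prod_cons, Finset.sum_cons, Finset.prod_cons,
      coeff_mul_add_eq_of_natDegree_le (h i (Finset.mem_cons_self _ _))
        ((natDegree_prod_le _ _).trans (Finset.sum_le_sum hs)), ih hs]

/-- In each term of the Leibniz expansion, the coefficient at the sum of the row bounds takes the
extreme coefficient from every factor. -/
theorem coeff_det_sum_of_natDegree_le (M : Matrix (Fin k) (Fin k) F[X]) (d : Fin k → ℕ)
    (h : ∀ i j, (M i j).natDegree ≤ d i) :
    M.det.coeff (∑ i, d i) = (Matrix.of fun i j => (M i j).coeff (d i)).det := by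
  rw [det_apply, det_apply, finsetSum_coeff]
  refine Finset.sum_congr rfl fun σ _ => ?_
  rw [coeff_smul, ← Equiv.sum_comp σ d,
    coeff_prod_sum_of_natDegree_le _ _ _ fun i _ => h (σ i) i]
  rfl

theorem natDegree_le_rowDegree (G : Matrix (Fin k) (Fin n) F[X]) (i : Fin k) (j : Fin n) :
    (G i j).natDegree ≤ rowDegree G i :=
  Finset.le_sup (f := fun j => (G i j).natDegree) (Finset.mem_univ j)

theorem IsBasic.exists_coeffMat_zero_mul_eq_one {G : Matrix (Fin k) (Fin n) F[X]}
    (hG : IsBasic G) : ∃ R : Matrix (Fin n) (Fin k) F, coeffMat G 0 * R = 1 := by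
  obtain ⟨R, hR⟩ := hG
  refine ⟨R.map constantCoeff, ?_⟩
  have := congrArg (fun M => M.map (constantCoeff : F[X] →+* F)) hR
  simp only [Matrix.map_mul, Matrix.map_one _ (map_zero _) (map_one _)] at this
  exact this

theorem IsBasic.le {G : Matrix (Fin k) (Fin n) F[X]} (hG : IsBasic G) : k ≤ n := by
  obtain ⟨R, hR⟩ := hG.exists_coeffMat_zero_mul_eq_one
  have := LinearMap.finrank_le_finrank_of_injective (f := (coeffMat G 0).vecMulLinear)
    (vecMul_injective_of_rightInverse hR)
  simpa using this

/-- The matrix of the leading coefficients of the rows. -/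
def leadMat (G : Matrix (Fin k) (Fin n) F[X]) : Matrix (Fin k) (Fin n) F :=
  Matrix.of fun i j => (G i j).coeff (rowDegree G i)

/-- A minimal encoder is row reduced. -/
theorem IsMinimalEncoder.vecMul_leadMat {𝒞 : Submodule F[X] (Fin n → F[X])}
    {G : Matrix (Fin k) (Fin n) F[X]} (hG : IsMinimalEncoder 𝒞 G) {c : Fin k → F}
    (hc : c ᵥ* leadMat G = 0) : c = 0 := by
  -- A zero minor also has `natDegree` 0, so if all row degrees vanish the degree condition yields
  -- no nonzero minor. There the leading matrix is G(0), which has a right inverse.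
  by_cases h0 : ∑ i, rowDegree G i = 0
  · obtain ⟨R, hR⟩ := hG.basic.exists_coeffMat_zero_mul_eq_one
    have hlead : leadMat G = coeffMat G 0 := by
      ext i j
      rw [leadMat, of_apply, Finset.sum_eq_zero_iff.1 h0 i (Finset.mem_univ i)]
      rfl
    rw [hlead] at hc
    refine vecMul_injective_of_rightInverse hR ?_
    simp only [hc, zero_vecMul]
  · have : Nonempty (Fin k ↪o Fin n) := ⟨Fin.castLEOrderEmb hG.basic.le⟩
    obtain ⟨e, -, he⟩ := Finset.exists_mem_eq_sup Finset.univ Finset.univ_nonempty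
      fun e : Fin k ↪o Fin n => (G.submatrix id e).det.natDegree
    have hdeg : ∑ i, rowDegree G i = (G.submatrix id e).det.natDegree := hG.minimal.trans he
    have hdet : ((leadMat G).submatrix id e).det ≠ 0 := by
      have h1 := coeff_det_sum_of_natDegree_le (G.submatrix id e) (rowDegree G)
        fun i j => natDegree_le_rowDegree G i (e j)
      have h2 : (leadMat G).submatrix id e =
        Matrix.of fun i j => (G.submatrix id e i j).coeff (rowDegree G i) := rfl
      rw [h2, ← h1, hdeg, coeff_natDegree, leadingCoeff_ne_zero]
      intro h
      rw [h, natDegree_zero] at hdeg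
      exact h0 hdeg
    refine eq_zero_of_vecMul_eq_zero hdet (funext fun j => ?_)
    exact congrFun hc (e j)

/-- The predictable degree property of row reduced matrices. -/
theorem coeff_eq_zero_of_rowReduced {G : Matrix (Fin k) (Fin n) F[X]}
    (hG : ∀ c : Fin k → F, c ᵥ* leadMat G = 0 → c = 0) {w : Fin k → F[X]} {N : ℕ}
    (hw : ∀ m, N ≤ m → coeffVec (w ᵥ* G) m = 0) {m : ℕ} (hm : N ≤ m) (i : Fin k) (b : ℕ)
    (hb : b + rowDegree G i = m) : (w i).coeff b = 0 := by
  obtain ⟨K, hK⟩ := exists_natDegree_le w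
  set K' := K + 1 + ∑ i, rowDegree G i with hK'
  have hrow : ∀ i, rowDegree G i ≤ ∑ i, rowDegree G i :=
    fun i => Finset.single_le_sum (f := rowDegree G) (fun _ _ => Nat.zero_le _) (Finset.mem_univ i)
  -- Downward induction on m, starting at K', beyond which the degree bound on w already gives zero.
  suffices H : ∀ t m, K' ≤ m + t → N ≤ m → ∀ i b, b + rowDegree G i = m → (w i).coeff b = 0 from
    H K' m (Nat.le_add_left _ _) hm i b hb
  intro t
  induction t with
  | zero =>
    intro m hKm _ i b hb
    have := hrow i
    exact coeff_eq_zero_of_natDegree_lt ((hK i).trans_lt (by omega))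
  | succ t ih =>
    intro m hKm hNm
    have hlarge : ∀ i b, m < b + rowDegree G i → (w i).coeff b = 0 :=
      fun i b hb => ih _ (by omega) (by omega) i b rfl
    -- With all higher contributions gone, the coefficient of D^m in wG involves only the leading
    -- row coefficients.
    have hc := hG (fun i => if rowDegree G i ≤ m then (w i).coeff (m - rowDegree G i) else 0) <| by
      rw [← hw m hNm]
      funext j
      simp only [vecMul, dotProduct, coeffVec, finsetSum_coeff, coeff_mul]
      refine Finset.sum_congr rfl fun i _ => ?_
      symm
      split_ifs with him
      · refine Finset.sum_eq_single (m - rowDegree G i, rowDegree G i) ?_ ?_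
        · rintro ⟨b, s⟩ hbs hne
          have hbs := Finset.HasAntidiagonal.mem_antidiagonal.1 hbs
          rcases lt_trichotomy s (rowDegree G i) with hs | hs | hs
          · rw [hlarge i b (by omega), zero_mul]
          · exact absurd (Prod.ext (by simp only at hbs ⊢; omega) hs) hne
          · rw [coeff_eq_zero_of_natDegree_lt ((natDegree_le_rowDegree G i j).trans_lt hs),
              mul_zero]
        · intro h
          exact absurd (Finset.HasAntidiagonal.mem_antidiagonal.2 (Nat.sub_add_cancel him)) h
      · rw [zero_mul]
        refine Finset.sum_eq_zero ?_
        rintro ⟨b, s⟩ hbs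
        have hbs := Finset.HasAntidiagonal.mem_antidiagonal.1 hbs
        rw [hlarge i b (by simp only at hbs; omega), zero_mul]
    intro i b hb
    have := congrFun hc i
    rwa [Pi.zero_apply, if_pos (by omega), show m - rowDegree G i = b by omega] at this

end LeadingCoefficients

/-! ### The controller canonical form as a realization. -/

section ControllerForm

variable {F : Type*} [Field F] {k n δ : ℕ} {G : Matrix (Fin k) (Fin n) F[X]}
  (h : ∑ i, rowDegree G i = δ)

/-- The state coordinate of `ccf G h` belonging to position `a` of the `i`-th block. -/
def statePos (i : Fin k) (a : ℕ) (ha : a < rowDegree G i) : Fin δ :=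
  (finSigmaFinEquiv.trans (finCongr h)) ⟨i, ⟨a, ha⟩⟩

theorem exists_eq_statePos (r : Fin δ) : ∃ i a ha, r = statePos h i a ha := by
  refine ⟨((finSigmaFinEquiv.trans (finCongr h)).symm r).1,
    ((finSigmaFinEquiv.trans (finCongr h)).symm r).2,
    ((finSigmaFinEquiv.trans (finCongr h)).symm r).2.2, ?_⟩
  exact ((finSigmaFinEquiv.trans (finCongr h)).apply_symm_apply r).symm

theorem statePos_inj {i i' : Fin k} {a a' : ℕ} {ha : a < rowDegree G i}
    {ha' : a' < rowDegree G i'} (hi : i = i') (haa : a = a') :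
    statePos h i a ha = statePos h i' a' ha' := by
  subst hi haa
  rfl

theorem sum_state {M : Type*} [AddCommMonoid M] (f : Fin δ → M) :
    ∑ r, f r = ∑ i, ∑ a : Fin (rowDegree G i), f (statePos h i a a.2) := by
  rw [← (finSigmaFinEquiv.trans (finCongr h)).sum_comp, Fintype.sum_sigma]
  rfl

theorem ccf_A_apply (i : Fin k) (a : ℕ) (ha : a < rowDegree G i) (i' : Fin k) (a' : ℕ)
    (ha' : a' < rowDegree G i') : (ccf G h).A (statePos h i a ha) (statePos h i' a' ha') =
      if i = i' ∧ a' = a + 1 then 1 else 0 := by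
  simp only [ccf, of_apply, statePos]
  rw [Equiv.symm_apply_apply, Equiv.symm_apply_apply]

theorem ccf_B_apply (i i' : Fin k) (a' : ℕ) (ha' : a' < rowDegree G i') :
    (ccf G h).B i (statePos h i' a' ha') = if i' = i ∧ a' = 0 then 1 else 0 := by
  simp only [ccf, of_apply, statePos]
  rw [Equiv.symm_apply_apply]

theorem ccf_C_apply (i : Fin k) (a : ℕ) (ha : a < rowDegree G i) (j : Fin n) :
    (ccf G h).C (statePos h i a ha) j = (G i j).coeff (a + 1) := by
  simp only [ccf, of_apply, statePos]
  rw [Equiv.symm_apply_apply]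

theorem ccf_A_mulVec (x : Fin δ → F) (i : Fin k) (a : ℕ) (ha : a < rowDegree G i) :
    ((ccf G h).A *ᵥ x) (statePos h i a ha) =
      if ha' : a + 1 < rowDegree G i then x (statePos h i (a + 1) ha') else 0 := by
  rw [mulVec, dotProduct]
  split_ifs with ha'
  · rw [Finset.sum_eq_single (statePos h i (a + 1) ha')]
    · rw [ccf_A_apply, if_pos ⟨rfl, rfl⟩, one_mul]
    · intro r _ hr
      obtain ⟨i', b, hb, rfl⟩ := exists_eq_statePos h r
      rw [ccf_A_apply, if_neg, zero_mul]
      exact fun hh => hr (statePos_inj h hh.1.symm hh.2)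
    · exact fun hh => absurd (Finset.mem_univ _) hh
  · refine Finset.sum_eq_zero fun r _ => ?_
    obtain ⟨i', b, hb, rfl⟩ := exists_eq_statePos h r
    rw [ccf_A_apply, if_neg, zero_mul]
    rintro ⟨rfl, rfl⟩
    exact ha' hb

theorem ccf_B_mulVec (x : Fin δ → F) (i : Fin k) :
    ((ccf G h).B *ᵥ x) i =
      if ha' : 0 < rowDegree G i then x (statePos h i 0 ha') else 0 := by
  rw [mulVec, dotProduct]
  split_ifs with ha'
  · rw [Finset.sum_eq_single (statePos h i 0 ha')]
    · rw [ccf_B_apply, if_pos ⟨rfl, rfl⟩, one_mul]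
    · intro r _ hr
      obtain ⟨i', b, hb, rfl⟩ := exists_eq_statePos h r
      rw [ccf_B_apply, if_neg, zero_mul]
      exact fun hh => hr (statePos_inj h hh.1 hh.2)
    · exact fun hh => absurd (Finset.mem_univ _) hh
  · refine Finset.sum_eq_zero fun r _ => ?_
    obtain ⟨i', b, hb, rfl⟩ := exists_eq_statePos h r
    rw [ccf_B_apply, if_neg, zero_mul]
    rintro ⟨rfl, rfl⟩
    exact ha' hb

theorem ccf_A_pow_mulVec (s : ℕ) (x : Fin δ → F) (i : Fin k) (a : ℕ) (ha : a < rowDegree G i) :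
    ((ccf G h).A ^ s *ᵥ x) (statePos h i a ha) =
      if ha' : a + s < rowDegree G i then x (statePos h i (a + s) ha') else 0 := by
  induction s generalizing a with
  | zero => simp [ha]
  | succ s ih =>
    rw [pow_succ', ← mulVec_mulVec, ccf_A_mulVec]
    by_cases h1 : a + 1 < rowDegree G i
    · rw [dif_pos h1, ih]
      by_cases h2 : a + 1 + s < rowDegree G i
      · rw [dif_pos h2, dif_pos (by omega)]
        exact congrArg x (statePos_inj h rfl (by omega))
      · rw [dif_neg h2, dif_neg (by omega)]
    · rw [dif_neg h1, dif_neg (by omega)]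

theorem ccf_response (s : ℕ) (i : Fin k) (a : ℕ) (ha : a < rowDegree G i) (j : Fin n) :
    ((ccf G h).A ^ s * (ccf G h).C) (statePos h i a ha) j = (G i j).coeff (a + s + 1) := by
  change ((ccf G h).A ^ s *ᵥ fun r => (ccf G h).C r j) (statePos h i a ha) = _
  rw [ccf_A_pow_mulVec]
  split_ifs with hs
  · rw [ccf_C_apply]
  · exact (coeff_eq_zero_of_natDegree_lt
      ((natDegree_le_rowDegree G i j).trans_lt (by omega))).symm

include h in
theorem rowDegree_le (i : Fin k) : rowDegree G i ≤ δ :=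
  h ▸ Finset.single_le_sum (f := rowDegree G) (fun _ _ => Nat.zero_le _) (Finset.mem_univ i)

/-- The controller canonical form of a minimal encoder realizes it. -/
theorem ccf_realizes {𝒞 : Submodule F[X] (Fin n → F[X])} (hG : IsMinimalEncoder 𝒞 G) :
    Realizes (ccf G h) G where
  coeff_zero := rfl
  coeff_succ s := by
    ext i j
    rw [Matrix.mul_assoc]
    change ((ccf G h).B *ᵥ fun r => ((ccf G h).A ^ s * (ccf G h).C) r j) i = _
    rw [ccf_B_mulVec]
    split_ifs with hi
    · rw [ccf_response, zero_add]
      rfl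
    · exact (coeff_eq_zero_of_natDegree_lt
        ((natDegree_le_rowDegree G i j).trans_lt (by omega))).symm
  nilpotent := by
    refine ⟨δ, ?_⟩
    refine ext_of_mulVec_single fun t => ?_
    rw [zero_mulVec]
    funext r
    obtain ⟨i, a, ha, rfl⟩ := exists_eq_statePos h r
    have := rowDegree_le h i
    rw [ccf_A_pow_mulVec, dif_neg (by omega)]
    rfl
  reachable x hx := by
    funext r
    obtain ⟨i, a, ha, rfl⟩ := exists_eq_statePos h r
    have := congrFun (hx a) i
    rw [← mulVec_mulVec, ccf_B_mulVec, dif_pos (by omega), ccf_A_pow_mulVec,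
      dif_pos (by omega)] at this
    exact (congrArg x (statePos_inj h rfl (by omega))).trans this
  observable x f hf hmem := by
    obtain ⟨u, hu⟩ := hmem
    have hu : u ᵥ* G = f := hu
    -- An input that steers the zero state to x at time δ: a symbol fed in at time δ - 1 - a has
    -- reached register a by then. Hence vG continues from time δ on as the zero-input response f of
    -- x.
    set v : Fin k → F[X] := fun i => ∑ a : Fin (rowDegree G i),
      C (x (statePos h i a a.2)) * X ^ (δ - 1 - (a : ℕ)) with hv
    have hvG : ∀ t, coeffVec (v ᵥ* G) (δ + t) = coeffVec f t := by
      intro t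
      rw [hf]
      funext j
      rw [vecMul, dotProduct, sum_state h]
      simp only [ccf_response, coeffVec, vecMul, dotProduct, hv, finsetSum_coeff, Finset.sum_mul]
      refine Finset.sum_congr rfl fun i _ => Finset.sum_congr rfl fun a _ => ?_
      have h1 := rowDegree_le h i
      have h2 := a.2
      rw [mul_assoc, coeff_C_mul, coeff_X_pow_mul', if_pos (by omega)]
      congr 2
      omega
    have hw : ∀ m, δ ≤ m → coeffVec ((v - (X ^ δ : F[X]) • u) ᵥ* G) m = 0 := by
      intro m hm
      obtain ⟨t, rfl⟩ := Nat.exists_eq_add_of_le hm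
      have h1 : coeffVec ((X ^ δ : F[X]) • f) (δ + t) = coeffVec f t := by
        rw [coeffVec_X_pow_smul, if_pos hm, Nat.add_sub_cancel_left]
      rw [sub_vecMul, smul_vecMul, hu]
      have h2 : coeffVec (v ᵥ* G - (X ^ δ : F[X]) • f) (δ + t) =
          coeffVec (v ᵥ* G) (δ + t) - coeffVec ((X ^ δ : F[X]) • f) (δ + t) := by
        funext j
        simp [coeffVec]
      rw [h2, h1, hvG, sub_self]
    funext r
    obtain ⟨i, a, ha, rfl⟩ := exists_eq_statePos h r
    have h1 := rowDegree_le h i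
    -- Since a is less than the i-th row degree, the total degree here is at least δ, where wG
    -- vanishes. The term D^δ u has no coefficient at δ - 1 - a, which leaves the state entry at (i,
    -- a).
    have key := coeff_eq_zero_of_rowReduced (fun c => hG.vecMul_leadMat) hw
      (m := δ - 1 - a + rowDegree G i) (by omega) i (δ - 1 - a) rfl
    rw [Pi.sub_apply, Pi.smul_apply, smul_eq_mul, coeff_sub, coeff_X_pow_mul',
      if_neg (by omega), sub_zero, hv, finsetSum_coeff,
      Finset.sum_eq_single (⟨a, ha⟩ : Fin (rowDegree G i))] at key
    · simpa using key
    · intro b _ hb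
      have h2 := b.2
      rw [coeff_C_mul, coeff_X_pow, if_neg, mul_zero]
      intro hh
      exact hb (Fin.ext (by simp only; omega))
    · exact fun hh => absurd (Finset.mem_univ _) hh

end ControllerForm

/-! ### Identification of the dual section with the orthogonal section. -/

section Equivalence

variable {F : Type*} [Field F] {k k' n δ δ' : ℕ}
  {S : Quadruple F k n δ} {S' : Quadruple F k' n δ'}
  {G : Matrix (Fin k) (Fin n) F[X]} {G' : Matrix (Fin k') (Fin n) F[X]}

/-- The parametrization of the section of `S'`, with states transformed by `M`. -/
def sectionMap (S' : Quadruple F k' n δ') (M : Matrix (Fin δ') (Fin δ) F) :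
    ((Fin δ' → F) × (Fin k' → F)) →ₗ[F] (Fin δ → F) × (Fin δ → F) × (Fin n → F) where
  toFun p := (p.1 ᵥ* M, (p.1 ᵥ* S'.A + p.2 ᵥ* S'.B) ᵥ* M, p.1 ᵥ* S'.C + p.2 ᵥ* S'.E)
  map_add' p q := by
    ext1
    · simp [add_vecMul]
    · ext1
      · simp only [Prod.fst_add, Prod.snd_add, add_vecMul]; abel
      · simp only [Prod.fst_add, Prod.snd_add, add_vecMul]; abel
  map_smul' c p := by
    simp [smul_vecMul, add_vecMul]

/-- The equations of the section orthogonal to `S`. -/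
def orthSectionMap (S : Quadruple F k n δ) :
    ((Fin δ → F) × (Fin δ → F) × (Fin n → F)) →ₗ[F] (Fin δ → F) × (Fin k → F) where
  toFun p := (p.1 - (S.A *ᵥ p.2.1 - S.C *ᵥ p.2.2), S.B *ᵥ p.2.1 - S.E *ᵥ p.2.2)
  map_add' p q := by
    ext1
    · simp only [Prod.fst_add, Prod.snd_add, mulVec_add]; abel
    · simp only [Prod.fst_add, Prod.snd_add, mulVec_add]; abel
  map_smul' c p := by
    simp [mulVec_smul, smul_sub]

theorem finrank_ker_orthSectionMap {R : Matrix (Fin n) (Fin k) F} (hR : S.E * R = 1) :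
    Module.finrank F (LinearMap.ker (orthSectionMap S)) + k = δ + n := by
  have hsurj : LinearMap.range (orthSectionMap S) = ⊤ := by
    rw [LinearMap.range_eq_top]
    rintro ⟨a, b⟩
    refine ⟨(a + S.C *ᵥ (R *ᵥ b), 0, -(R *ᵥ b)), ?_⟩
    ext1
    · simp [orthSectionMap, mulVec_neg]
    · simp [orthSectionMap, mulVec_neg, hR]
  have := LinearMap.finrank_range_add_finrank_ker (orthSectionMap S)
  rw [hsurj, finrank_top] at this
  simp only [Module.finrank_prod, Module.finrank_fin_fun] at this
  omega

theorem finrank_range_sectionMap {R : Matrix (Fin n) (Fin k') F} (hR : S'.E * R = 1)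
    {M : Matrix (Fin δ') (Fin δ) F} (hM : ∀ x, x ᵥ* M = 0 → x = 0) :
    Module.finrank F (LinearMap.range (sectionMap S' M)) = δ' + k' := by
  rw [LinearMap.finrank_range_of_inj, Module.finrank_prod, Module.finrank_fin_fun,
    Module.finrank_fin_fun]
  rw [← LinearMap.ker_eq_bot, LinearMap.ker_eq_bot']
  rintro ⟨x, u⟩ hxu
  have h1 : x ᵥ* M = 0 := congrArg Prod.fst hxu
  have h2 : x ᵥ* S'.C + u ᵥ* S'.E = 0 := congrArg (fun p => p.2.2) hxu
  have hx := hM x h1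
  rw [hx, zero_vecMul, zero_add] at h2
  have hu : u = 0 := vecMul_injective_of_rightInverse hR (by simp only [h2, zero_vecMul])
  rw [hx, hu]
  rfl

/-- Realizations of a code and of its sequence space dual: the dimensions are complementary, the
state spaces have the same dimension, and the section of the dual code is isomorphic to the
section orthogonal to that of the code. -/
theorem exists_state_correspondence (h : Realizes S G) (h' : Realizes S' G') (hG : IsBasic G)
    (hG' : IsBasic G') (hdual : im G' = seqDual (im G)) :
    k + k' = n ∧ δ' = δ ∧ ∃ M : Matrix (Fin δ') (Fin δ) F,
      (∀ x, x ᵥ* M = 0 → x = 0) ∧ ∀ x y d,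
        (∃ u, y = x ᵥ* S'.A + u ᵥ* S'.B ∧ d = x ᵥ* S'.C + u ᵥ* S'.E) ↔
          x ᵥ* M = S.A *ᵥ (y ᵥ* M) - S.C *ᵥ d ∧ S.B *ᵥ (y ᵥ* M) = S.E *ᵥ d := by
  obtain ⟨N₁, hN₁⟩ := h.nilpotent
  obtain ⟨N₂, hN₂⟩ := h'.nilpotent
  obtain ⟨R, hR⟩ := hG.exists_coeffMat_zero_mul_eq_one
  obtain ⟨R', hR'⟩ := hG'.exists_coeffMat_zero_mul_eq_one
  rw [← h.coeff_zero] at hR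
  rw [← h'.coeff_zero] at hR'
  have hN : S.A ^ (N₁ + N₂) = 0 := by rw [pow_add, hN₁, Matrix.zero_mul]
  have hN' : S'.A ^ (N₁ + N₂) = 0 := by rw [pow_add, hN₂, Matrix.mul_zero]
  set N := N₁ + N₂
  have hO : Orth (N + 1) G G' := orth_of_im_le_seqDual (fun t => h.coeffMat_eq_zero hN)
    (fun t => h'.coeffMat_eq_zero hN') hdual.le
  have hM : ∀ x, x ᵥ* stateMatrix N S S' = 0 → x = 0 :=
    fun x => stateMatrix_vecMul_eq_zero h h' hN hN' hO hdual.ge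
  have hMt : ∀ x, x ᵥ* stateMatrix N S' S = 0 → x = 0 :=
    fun x => stateMatrix_vecMul_eq_zero h' h hN' hN hO.symm (hdual ▸ seqDual_seqDual_le hG)
  have hle : ∀ {a b : ℕ} {M : Matrix (Fin a) (Fin b) F}, (∀ x, x ᵥ* M = 0 → x = 0) → a ≤ b := by
    intro a b M hM
    have hinj : Function.Injective M.vecMulLinear := by
      rw [← LinearMap.ker_eq_bot, LinearMap.ker_eq_bot']
      exact hM
    simpa using LinearMap.finrank_le_finrank_of_injective hinj
  have hδ : δ' = δ := le_antisymm (hle hM) (hle hMt)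
  have hsub : LinearMap.range (sectionMap S' (stateMatrix N S S')) ≤
      LinearMap.ker (orthSectionMap S) := by
    rintro _ ⟨⟨x, u⟩, rfl⟩
    obtain ⟨h1, h2⟩ := section_map h h' hN hO (x := x) (u := u) rfl rfl
    exact Prod.ext (sub_eq_zero.2 h1) (sub_eq_zero.2 h2)
  have hr := finrank_range_sectionMap hR' hM
  have hk := finrank_ker_orthSectionMap hR
  have hmono := Submodule.finrank_mono hsub
  have hn := le_add_of_seqDual_le hG hdual.ge
  -- The dimensions are δ' + k' and δ + n - k. With δ' = δ, the inclusion gives k + k' ≤ n and `hn`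
  -- the converse.
  have heq := Submodule.eq_of_le_of_finrank_eq hsub (by omega)
  refine ⟨by omega, hδ, stateMatrix N S S', hM, fun x y d => ⟨?_, ?_⟩⟩
  · rintro ⟨u, hy, hd⟩
    exact section_map h h' hN hO hy hd
  · rintro ⟨h1, h2⟩
    have hmem : (x ᵥ* stateMatrix N S S', y ᵥ* stateMatrix N S S', d) ∈
        LinearMap.ker (orthSectionMap S) :=
      Prod.ext (sub_eq_zero.2 h1) (sub_eq_zero.2 h2)
    rw [← heq] at hmem
    obtain ⟨⟨x', u⟩, hxu⟩ := hmem
    have e1 : x' ᵥ* stateMatrix N S S' = x ᵥ* stateMatrix N S S' := congrArg Prod.fst hxu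
    have e2 : (x' ᵥ* S'.A + u ᵥ* S'.B) ᵥ* stateMatrix N S S' = y ᵥ* stateMatrix N S S' :=
      congrArg (fun p => p.2.1) hxu
    have e3 : x' ᵥ* S'.C + u ᵥ* S'.E = d := congrArg (fun p => p.2.2) hxu
    have hinj : ∀ {a b : Fin δ' → F}, a ᵥ* stateMatrix N S S' = b ᵥ* stateMatrix N S S' →
        a = b := fun hab => sub_eq_zero.1 (hM _ (by rw [sub_vecMul, hab, sub_self]))
    obtain rfl := hinj e1
    exact ⟨u, (hinj e2).symm, e3.symm⟩

end Equivalence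

end

end ConvCode

/-! ### The MacWilliams duality theorem. -/

theorem theorem6p3 {F : Type*} [Field F] [Fintype F] [DecidableEq F]
    {p : ℕ} [Fact p.Prime] [Algebra (ZMod p) F]
    {ζ : ℂ} (hζ : IsPrimitiveRoot ζ p)
    {n k δ : ℕ} (𝒞 : Submodule F[X] (Fin n → F[X]))
    (S : ConvCode.Quadruple F k n δ) (hS : S.IsCCFOf 𝒞) :
    -- every CCF of the sequence space dual has `n - k` inputs and state space `F^δ`
    (∀ (k' δ' : ℕ) (S' : ConvCode.Quadruple F k' n δ'),
      S'.IsCCFOf (ConvCode.seqDual 𝒞) → k + k' = n ∧ δ' = δ) ∧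
    ∀ (k' : ℕ) (S' : ConvCode.Quadruple F k' n δ), S'.IsCCFOf (ConvCode.seqDual 𝒞) →
      (∃ Q : GL (Fin δ) F, ∀ x y : Fin δ → F,
        S'.wam (x ᵥ* (Q : Matrix (Fin δ) (Fin δ) F)) (y ᵥ* (Q : Matrix (Fin δ) (Fin δ) F)) =
          ((Fintype.card F : ℂ) ^ k)⁻¹ •
            ConvCode.macWilliams (Fintype.card F) n
              (ConvCode.conj (ConvCode.macMatrix F δ p ζ) S.wam x y)) ∧
      ConvCode.genWam S'.wam =
        (fun M => ((Fintype.card F : ℂ) ^ k)⁻¹ •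
          (ConvCode.conj (ConvCode.macMatrix F δ p ζ) M).map
            (ConvCode.macWilliams (Fintype.card F) n)) '' ConvCode.genWam S.wam := by
  obtain ⟨G, hG, -, hδ, rfl⟩ := hS
  have hreal := ConvCode.ccf_realizes hδ hG
  refine ⟨?_, ?_⟩
  · rintro k' δ' _ ⟨G', hG', -, hδ', rfl⟩
    obtain ⟨h1, h2, -⟩ := ConvCode.exists_state_correspondence hreal
      (ConvCode.ccf_realizes hδ' hG') hG.basic hG'.basic (by rw [hG'.im_eq, hG.im_eq])
    exact ⟨h1, h2⟩
  · rintro k' _ ⟨G', hG', -, hδ', rfl⟩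
    obtain ⟨-, -, M, hM, hsec⟩ := ConvCode.exists_state_correspondence hreal
      (ConvCode.ccf_realizes hδ' hG') hG.basic hG'.basic (by rw [hG'.im_eq, hG.im_eq])
    have hunit : IsUnit M := Matrix.vecMul_injective_iff_isUnit.1 fun a b hab =>
      sub_eq_zero.1 (hM _ (by rw [Matrix.sub_vecMul]; exact sub_eq_zero.2 hab))
    obtain ⟨P, rfl⟩ := hunit
    obtain ⟨R, hR⟩ := hG.basic.exists_coeffMat_zero_mul_eq_one
    -- M carries the states of the dual CCF to those of the orthogonal section, so Q is the inverse
    -- of M.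
    have hQ : ∀ x y : Fin δ → F,
        (ConvCode.ccf G' hδ').wam
          (x ᵥ* ((P⁻¹ : GL (Fin δ) F) : Matrix (Fin δ) (Fin δ) F))
          (y ᵥ* ((P⁻¹ : GL (Fin δ) F) : Matrix (Fin δ) (Fin δ) F)) =
          ((Fintype.card F : ℂ) ^ k)⁻¹ •
            ConvCode.macWilliams (Fintype.card F) n
              (ConvCode.conj (ConvCode.macMatrix F δ p ζ) (ConvCode.ccf G hδ).wam x y) := by
      intro x y
      have hcancel : ∀ z : Fin δ → F, (z ᵥ* ((P⁻¹ : GL (Fin δ) F) : Matrix (Fin δ) (Fin δ) F)) ᵥ*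
          (P : Matrix (Fin δ) (Fin δ) F) = z := by
        intro z
        rw [Matrix.vecMul_vecMul, ← Units.val_mul, inv_mul_cancel, Units.val_one,
          Matrix.vecMul_one]
      rw [ConvCode.macWilliams_conj_wam hζ hR, ConvCode.Quadruple.wam, Matrix.of_apply]
      congr 1
      ext d
      exact (hsec _ _ d).trans (by rw [hcancel, hcancel]; rfl)
    exact ⟨⟨P⁻¹, hQ⟩, ConvCode.genWam_eq_image _ _ hQ⟩
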